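/- Let $n\ge 1$ and let $(\tau_1,\dots,\tau_n)\in(0,\infty)^n$ have joint probability density $$\frac1{Z_n}\prod_{j=1}^n\tau_j^{-3n}e^{-n/\tau_j}\prod_{1\le j<k\le n}|\tau_k-\tau_j|^2$$ (the proper delay times for $\beta=2$ and $n$ channels). Let $\tau_{\mathrm W}=\frac1n\sum_{j=1}^n\tau_j$ be the Wigner delay time, $\xi_n(z)=\log\mathbb E\,e^{z\tau_{\mathrm W}}$ for $z\le 0$, and for $1\le l\le n$ let $K_l=K_l(n)$ be the $l$-th cumulant of $\tau_{\mathrm W}$, i.e. the $l$-th one-sided derivative of $\xi_n$ at $0$. Then $$\xi_n(z)=\sum_{l=1}^{n}\frac{K_l}{l!}z^l+o(z^n),\qquad z\to0^-.$$ For every $l\ge 1$ the limit $$p_l=\lim_{n\to\infty}\frac{n^{2l-2}K_l(n)}{(l-1)!}$$ exists and is an integer. The $p_l$ satisfy, with $p_1=1$, the recurrence $$(l+1)p_{l+1}=2(2l-1)p_l+2\sum_{i=0}^{l-1}(3i+1)(l-i)p_{i+1}p_{l-i},\qquad l\ge1.$$ The generating function $F(z)=\sum_{i\ge1}p_iz^i$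 is, as a formal power series, $$F(z)=\tfrac32-\tfrac32\Omega(z)+2z\Omega(z)^3+3z\Omega(z)^2+2z\Omega(z),$$ where $\Omega$ is the unique power series with $\Omega(0)=1$ that satisfies $$4z\Omega^4+8z\Omega^3+(4z-3)\Omega^2+2\Omega+1=0 .$$ It is given explicitly by $\Omega(z)=1+\sum_{k\ge1}\zeta_kz^k$ with $$\zeta_k=\frac4k\sum_{i=0}^{k-1}\binom{2k-i-2}{k-1}\left(\sum_{p=0}^{i}\binom{2k}{p}\binom{2k}{i-p}2^{i+p}\right)(-3)^{k-1-i},$$ and all $\zeta_k$ are integers. Both series $\Omega$ and $F$ have a positive radius of convergence. -/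

import Mathlib

open Filter Topology MeasureTheory ProbabilityTheory Asymptotics PowerSeries

noncomputable section

/-- Unnormalised joint density of the proper delay times `τ₁, …, τₙ` for `β = 2`, in units in
which the Heisenberg time is `n`:
`∏ⱼ τⱼ^(-b) exp(-n / τⱼ) ∏_{j < k} |τₖ - τⱼ|²` with `b = 3 β n / 2 + 2 - β = 3 n`. -/
def delayWeight (n : ℕ) (τ : Fin n → ℝ) : ℝ :=
  (∏ j : Fin n, ((τ j) ^ (3 * n))⁻¹ * Real.exp (-((n : ℝ) / τ j))) *
    ∏ j : Fin n, ∏ k ∈ Finset.Ioi j, |τ k - τ j| ^ 2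

/-- The measure on `(0, ∞)ⁿ` with density `delayWeight n`, before normalisation. -/
def delayMeasure (n : ℕ) : Measure (Fin n → ℝ) :=
  (volume.restrict {τ : Fin n → ℝ | ∀ j, 0 < τ j}).withDensity
    (fun τ => ENNReal.ofReal (delayWeight n τ))

/-- The joint law of the proper delay times (`β = 2`, `n` channels). -/
def delayLaw (n : ℕ) : Measure (Fin n → ℝ) :=
  (delayMeasure n Set.univ)⁻¹ • delayMeasure n

/-- The Wigner delay time: the average of the proper delay times. -/
def wignerDelayTime (n : ℕ) (τ : Fin n → ℝ) : ℝ :=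
  (1 / (n : ℝ)) * ∑ j : Fin n, τ j

/-- The cumulant generating function `ξₙ(z) = log 𝔼 exp (z τ_W)`. The expectation is finite
only for `z ≤ 0`. -/
def delayCgf (n : ℕ) (z : ℝ) : ℝ :=
  cgf (wignerDelayTime n) (delayLaw n) z

/-- The `l`-th cumulant of the Wigner delay time (`1 ≤ l ≤ n`): the `l`-th derivative at `0` of
the cumulant generating function. The derivative is one-sided, since the generating function is
only finite on `(-∞, 0]`. -/
def delayCumulant (n l : ℕ) : ℝ :=
  iteratedDerivWithin l (delayCgf n) (Set.Iic 0) 0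

/-- The explicit Taylor coefficients `ζₖ`, for `k ≥ 1`, as rational numbers. -/
def zetaCoeff (k : ℕ) : ℚ :=
  (4 / (k : ℚ)) * ∑ i ∈ Finset.range k,
    ((2 * k - i - 2).choose (k - 1) : ℚ) *
      (∑ p ∈ Finset.range (i + 1),
        ((2 * k).choose p : ℚ) * ((2 * k).choose (i - p) : ℚ) * 2 ^ (i + p)) *
      (-3) ^ (k - 1 - i)

/-- `Ω(z) = 1 + ∑_{k ≥ 1} ζₖ zᵏ`. -/
def omegaSeries : PowerSeries ℚ :=
  PowerSeries.mk fun k => if k = 0 then 1 else zetaCoeff k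

/-- The generating function `F(z) = ∑_{i ≥ 1} pᵢ zⁱ`. -/
def genSeries (p : ℕ → ℤ) : PowerSeries ℚ :=
  PowerSeries.mk fun i => if i = 0 then 0 else (p i : ℚ)

/-- The series `W` is a root of the quartic
`4 z W⁴ + 8 z W³ + (4 z - 3) W² + 2 W + 1 = 0`, where `z` is the variable. -/
def IsQuarticRoot (W : PowerSeries ℚ) : Prop :=
  4 * X * W ^ 4 + 8 * X * W ^ 3 + (4 * X - 3) * W ^ 2 + 2 * W + 1 = 0

end

/-! The proof joins an integrable-systems argument at finite `n` to an explicit solution of the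
limiting recurrence.

Finite `n`. By `andreief`, the expectation of `exp (z τ_W)` is `D(z) / D(0)`, where `D` is the `n ×
n` Hankel determinant of the tilted one-particle moments `m_k(z)`, and `m_k' = m_{k+1}`. Only
finitely many moments are finite at `z = 0`, just enough for `D` and `ξₙ` to be `n` times
continuously differentiable up to `0`; Taylor's theorem then gives the expansion. Integration by
parts gives a three-term relation between moments (`delayMoment_recurrence`). Let the power sum
`p_k` act on minors by raising one exponent by `k`, so that `p₁` is `d/dz`. The three-term relation
becomes Virasoro constraints (`virasoro_hankelMinor`), and a Plücker relation becomes the first KP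
equation in `p₁, p₂, p₃` (`hankelMinor_plucker`). Eliminating `p₂` and `p₃` leaves a bilinear
differential equation for `D` (`hankel_bilinear`), hence a third-order equation for `ξₙ'`. Its
Taylor coefficients give a recurrence for `K_{l+1} / l!` with leading factor `(l + 2) (n² - (l +
1)²)` (`normalizedCumulant_succ`); rescaling by powers of `n` and letting `n → ∞` gives the stated
recurrence.

Limit. The quartic reads `4 z Ω² (Ω + 1)² = (Ω - 1) (3 Ω + 1)`, so `Ω = 1 + 4 V` with `V (1 + 3 V) =
z (1 + 4 V)² (1 + 2 V)²`, which has a solution `V` over `ℤ`. The antiderivative of `Ω` is an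
integral polynomial in `z` and `V` (`derivative_uniformized`), and it solves the first-order
equation that encodes the recurrence. Thus the `p_l` are integers, Lagrange inversion yields `ζₖ`,
and crude bounds on `ζₖ` yield convergence. -/

/-! ### Lagrange inversion -/

/-- With `u = X q`, this coefficient is the residue of `u' / u ^ (a + 1)`: an exact derivative for
`a > 0`, a logarithmic derivative for `a = 0`. The proof stays within power series by using that `X
f'` and `a f` have the same coefficient at `a`. -/
theorem PowerSeries.coeff_inv_pow_mul_derivative {K : Type*} [Field K] [CharZero K] {q : K⟦X⟧}
    (hq : constantCoeff q ≠ 0) (a : ℕ) :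
    coeff a (q⁻¹ ^ (a + 1) * d⁄dX K (X * q)) = if a = 0 then 1 else 0 := by
  have hqi : q⁻¹ * q = 1 := PowerSeries.inv_mul_cancel q hq
  have hd : d⁄dX K (X * q) = q + X * d⁄dX K q := by
    rw [Derivation.leibniz]; simp [add_comm]
  rw [hd]
  rcases a with _ | a
  · have : q⁻¹ ^ (0 + 1) * (q + X * d⁄dX K q) = 1 + X * (q⁻¹ * d⁄dX K q) := by
      linear_combination hqi
    rw [this]; simp
  · have hr : d⁄dX K (q⁻¹ ^ (a + 1)) = -((a : K⟦X⟧) + 1) * (q⁻¹ ^ (a + 2) * d⁄dX K q) := by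
      rw [derivative_pow, derivative_inv']
      push_cast
      ring
    have key : ((a : K⟦X⟧) + 1) * (q⁻¹ ^ (a + 1 + 1) * (q + X * d⁄dX K q)) =
        ((a : K⟦X⟧) + 1) * q⁻¹ ^ (a + 1) - X * d⁄dX K (q⁻¹ ^ (a + 1)) := by
      rw [hr]
      linear_combination ((a : K⟦X⟧) + 1) * q⁻¹ ^ (a + 1) * hqi
    have hC : ((a : K⟦X⟧) + 1) = C ((a : K) + 1) := by simp
    have := congrArg (coeff (a + 1)) key
    rw [map_sub, hC, coeff_C_mul, coeff_C_mul, coeff_succ_X_mul, coeff_derivative, mul_comm (coeff _ _),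
      sub_self] at this
    have h0 : (a : K) + 1 ≠ 0 := Nat.cast_add_one_ne_zero a
    simpa [h0] using this

theorem PowerSeries.constantCoeff_subst_of_constantCoeff_zero {K : Type*} [CommRing K] {u : K⟦X⟧}
    (hu : constantCoeff u = 0) (f : K⟦X⟧) :
    constantCoeff (f.subst u) = constantCoeff f := by
  have hs : HasSubst u := HasSubst.of_constantCoeff_zero' hu
  obtain ⟨g, hg⟩ : X ∣ f - C (constantCoeff f) := by
    rw [X_dvd_iff]; simp
  have hf : f = X * g + C (constantCoeff f) := by rw [← hg]; ring
  have h1 : f.subst u = u * g.subst u + C (constantCoeff f) := by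
    conv_lhs => rw [hf]
    rw [subst_add hs, subst_mul hs, subst_X hs, subst_C]
    rfl
  rw [h1]; simp [hu]

/-- **Lagrange inversion.** -/
theorem PowerSeries.lagrange_inversion {K : Type*} [Field K] [CharZero K] {u φ : K⟦X⟧}
    (hφ : constantCoeff φ ≠ 0) (hu0 : constantCoeff u = 0) (hu : u = X * φ.subst u) (k : ℕ) :
    ((k : K) + 1) * coeff (k + 1) u = coeff k (φ ^ (k + 1)) := by
  have hs : HasSubst u := HasSubst.of_constantCoeff_zero' hu0
  set q := φ.subst u with hqdef
  have hq : constantCoeff q ≠ 0 := by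
    rwa [hqdef, constantCoeff_subst_of_constantCoeff_zero hu0]
  have hqi : q⁻¹ * q = 1 := PowerSeries.inv_mul_cancel q hq
  set c := φ ^ (k + 1) with hc
  obtain ⟨R, hR⟩ : X ^ (k + 1) ∣ c - ((trunc (k + 1) c : Polynomial K) : K⟦X⟧) := by
    rw [X_pow_dvd_iff]
    intro m hm
    rw [map_sub, Polynomial.coeff_coe, coeff_trunc, if_pos hm, sub_self]
  -- Only the first `k + 1` coefficients of `φ ^ (k + 1)` matter: after substitution the tail is a
  -- multiple of `u ^ (k + 1)`, hence of `X ^ (k + 1)`.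
  have hqk : q ^ (k + 1) = ∑ j ∈ Finset.range (k + 1), C (coeff j c) * u ^ j +
      u ^ (k + 1) * R.subst u := by
    rw [hqdef, ← subst_pow hs, ← hc]
    have : c = ((trunc (k + 1) c : Polynomial K) : K⟦X⟧) + X ^ (k + 1) * R := by rw [← hR]; ring
    conv_lhs => rw [this]
    rw [subst_add hs, subst_mul hs, subst_pow hs, subst_X hs, subst_coe hs,
      Polynomial.aeval_eq_sum_range' (n := k + 1) (by exact natDegree_trunc_lt c k)]
    congr 1
    refine Finset.sum_congr rfl fun j hj => ?_
    rw [coeff_trunc, if_pos (Finset.mem_range.1 hj), smul_eq_C_mul]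
  have hdu : d⁄dX K u = q⁻¹ ^ (k + 1) * q ^ (k + 1) * d⁄dX K u := by
    rw [← mul_pow, hqi]; simp
  -- Residue of `u ^ j u' / u ^ (k + 1)`: only `j = k` survives.
  have hterm : ∀ j ∈ Finset.range (k + 1),
      coeff k (q⁻¹ ^ (k + 1) * (C (coeff j c) * u ^ j) * d⁄dX K u) =
        if j = k then coeff k c else 0 := by
    intro j hj
    have hjk : j ≤ k := Nat.lt_succ_iff.1 (Finset.mem_range.1 hj)
    obtain ⟨a, rfl⟩ := Nat.exists_eq_add_of_le hjk
    have : q⁻¹ ^ (j + a + 1) * (C (coeff j c) * u ^ j) * d⁄dX K u =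
        C (coeff j c) * (X ^ j * (q⁻¹ ^ (a + 1) * d⁄dX K (X * q))) := by
      rw [← hu]
      have h1 : u ^ j = X ^ j * q ^ j := by rw [← mul_pow, ← hu]
      have h2 : q⁻¹ ^ j * q ^ j = 1 := by rw [← mul_pow, hqi, one_pow]
      rw [h1]
      calc _ = C (coeff j c) * (X ^ j * (q⁻¹ ^ (a + 1) * d⁄dX K u)) * (q⁻¹ ^ j * q ^ j) := by ring
        _ = _ := by rw [h2, mul_one]
    rw [this, coeff_C_mul, add_comm j a, coeff_X_pow_mul, coeff_inv_pow_mul_derivative hq]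
    by_cases ha : a = 0
    · subst ha; simp
    · simp [ha]
  have hlast : coeff k (q⁻¹ ^ (k + 1) * (u ^ (k + 1) * R.subst u) * d⁄dX K u) = 0 := by
    have hx : X ^ (k + 1) ∣ q⁻¹ ^ (k + 1) * (u ^ (k + 1) * R.subst u) * d⁄dX K u := by
      refine Dvd.dvd.mul_right (Dvd.dvd.mul_left (Dvd.dvd.mul_right ?_ _) _) _
      exact pow_dvd_pow_of_dvd (Dvd.intro _ hu.symm) _
    exact (X_pow_dvd_iff.1 hx) k (Nat.lt_succ_self k)
  have hmain := congrArg (coeff k) hdu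
  rw [hqk, mul_add, add_mul, map_add, hlast, Finset.mul_sum, Finset.sum_mul, map_sum,
    Finset.sum_congr rfl hterm, coeff_derivative] at hmain
  simpa [mul_comm] using hmain

/-! ### The uniformizing series -/

/-- The quartic is uniformized by `z = v (1 + 3 v) / ((1 + 4 v) (1 + 2 v)) ^ 2`, with an integral
inverse series. -/
theorem exists_uniformizer : ∃ V : ℤ⟦X⟧, constantCoeff V = 0 ∧
    V + 3 * V ^ 2 = X * ((1 + 4 * V) ^ 2 * (1 + 2 * V) ^ 2) := by
  have hunit : IsUnit (((1 + 4 * X) ^ 2 * (1 + 2 * X) ^ 2 : ℤ⟦X⟧)) := by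
    rw [isUnit_iff_constantCoeff]; simp
  obtain ⟨I, hI⟩ := hunit.exists_right_inv
  set P : ℤ⟦X⟧ := (X + 3 * X ^ 2) * I with hP
  have hPQ : P * ((1 + 4 * X) ^ 2 * (1 + 2 * X) ^ 2) = X + 3 * X ^ 2 := by
    rw [hP]; linear_combination (X + 3 * X ^ 2) * hI
  have hP0 : constantCoeff P = 0 := by rw [hP]; simp
  have hI0 : constantCoeff I = 1 := by
    have := congrArg (constantCoeff (R := ℤ)) hI
    simpa using this
  have hP1 : coeff 1 P = 1 := by
    have : P = X * ((1 + 3 * X) * I) := by rw [hP]; ring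
    rw [this]
    refine (coeff_succ_X_mul 0 _).trans ?_
    simp [hI0]
  -- The linear coefficient is a unit of `ℤ`, so the compositional inverse has integer coefficients.
  have hu : IsUnit (coeff 1 P) := by rw [hP1]; exact isUnit_one
  set V := P.substInvOfIsUnit hu with hV
  have hV0 : constantCoeff V = 0 := constantCoeff_substInvOfIsUnit P hu
  have hs : HasSubst V := HasSubst.of_constantCoeff_zero' hV0
  refine ⟨V, hV0, ?_⟩
  have hPV : P.subst V = X := subst_substInvOfIsUnit_right P hP0 hu
  have := congrArg (substAlgHom (R := ℤ) hs) hPQ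
  simp only [map_mul, map_pow, map_add, map_one, map_ofNat, substAlgHom_X] at this
  rw [coe_substAlgHom, hPV] at this
  exact this.symm

theorem PowerSeries.coeff_one_add_C_mul_X_pow {R : Type*} [CommRing R] (a : R) (m p : ℕ) :
    coeff p ((1 + C a * X) ^ m) = (m.choose p : R) * a ^ p := by
  have : (1 + C a * X : R⟦X⟧) ^ m = rescale a (((1 + Polynomial.X) ^ m : Polynomial R) : R⟦X⟧) := by
    simp [Polynomial.coe_pow, Polynomial.coe_add, rescale_X]
  rw [this, coeff_rescale, Polynomial.coeff_coe, Polynomial.coeff_one_add_X_pow, mul_comm]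

theorem PowerSeries.coeff_inv_one_add_C_mul_X_pow {K : Type*} [Field K] (a : K) (d i : ℕ) :
    coeff i ((1 + C a * X : K⟦X⟧)⁻¹ ^ (d + 1)) = ((d + i).choose d : K) * (-a) ^ i := by
  have h : (1 + C a * X : K⟦X⟧)⁻¹ = rescale (-a) (mk 1) := by
    rw [PowerSeries.inv_eq_iff_mul_eq_one (by simp)]
    have := congrArg (rescale (-a)) (mk_one_mul_one_sub_eq_one K)
    simpa [rescale_X] using this
  rw [h, ← map_pow, mk_one_pow_eq_mk_choose_add, coeff_rescale, coeff_mk, mul_comm]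

/-- The coefficients `ζₖ` are the Lagrange coefficients of the uniformizing series. -/
theorem zetaCoeff_eq_coeff {u : ℚ⟦X⟧} (hu0 : constantCoeff u = 0)
    (hu : u + 3 * u ^ 2 = X * ((1 + 4 * u) ^ 2 * (1 + 2 * u) ^ 2)) (k : ℕ) :
    zetaCoeff (k + 1) = 4 * coeff (k + 1) u := by
  have hs : HasSubst u := HasSubst.of_constantCoeff_zero' hu0
  set A : ℚ⟦X⟧ := 1 + C 4 * X with hA
  set B : ℚ⟦X⟧ := 1 + C 2 * X with hB
  set E : ℚ⟦X⟧ := 1 + C 3 * X with hE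
  set φ : ℚ⟦X⟧ := A ^ 2 * B ^ 2 * E⁻¹ with hφ
  have hE0 : constantCoeff E ≠ 0 := by simp [hE]
  have hφE : φ * E = A ^ 2 * B ^ 2 := by
    rw [hφ, mul_assoc, PowerSeries.inv_mul_cancel _ hE0, mul_one]
  have hφ0 : constantCoeff φ ≠ 0 := by
    simp [hφ, hA, hB, hE]
  have hsub := congrArg (substAlgHom (R := ℚ) hs) hφE
  have hc : ∀ a : ℚ, substAlgHom (R := ℚ) hs (C a) = C a := fun a => by
    rw [coe_substAlgHom, subst_C]; rfl
  simp only [hA, hB, hE, map_mul, map_pow, map_add, map_one, substAlgHom_X, hc] at hsub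
  rw [coe_substAlgHom] at hsub
  have hu' : u = X * φ.subst u := by
    have hne : (1 + C 3 * u : ℚ⟦X⟧) ≠ 0 := by
      intro h
      have := congrArg (constantCoeff (R := ℚ)) h
      simp [hu0] at this
    apply mul_right_cancel₀ hne
    have h4 : (C 4 : ℚ⟦X⟧) = 4 := map_ofNat C 4
    have h3 : (C 3 : ℚ⟦X⟧) = 3 := map_ofNat C 3
    have h2 : (C 2 : ℚ⟦X⟧) = 2 := map_ofNat C 2
    rw [h4, h3, h2] at hsub
    rw [h3]
    linear_combination hu - X * hsub
  have hl := lagrange_inversion hφ0 hu0 hu' k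
  -- The three factors supply the binomials: the first two give the inner sum over `p`, the negative
  -- power of `1 + 3 X` gives the outer binomial and the power of `-3`.
  have hpow : φ ^ (k + 1) = A ^ (2 * (k + 1)) * B ^ (2 * (k + 1)) * E⁻¹ ^ (k + 1) := by
    rw [hφ, mul_pow, mul_pow, ← pow_mul, ← pow_mul]
  have hk : ((k : ℚ) + 1) ≠ 0 := Nat.cast_add_one_ne_zero k
  have h4 : 4 * coeff (k + 1) u = 4 / ((k : ℚ) + 1) * coeff k (φ ^ (k + 1)) := by
    rw [← hl]; field_simp
  rw [h4, zetaCoeff]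
  push_cast
  congr 1
  rw [hpow, coeff_mul, Finset.Nat.sum_antidiagonal_eq_sum_range_succ_mk]
  refine Finset.sum_congr rfl fun i hi => ?_
  have hik : i ≤ k := Nat.lt_succ_iff.1 (Finset.mem_range.1 hi)
  simp only [coeff_mul, hA, hB, hE, coeff_one_add_C_mul_X_pow, coeff_inv_one_add_C_mul_X_pow]
  rw [Finset.Nat.sum_antidiagonal_eq_sum_range_succ_mk, show 2 * (k + 1) - i - 2 = k + (k - i) by omega,
    mul_comm ((k + (k - i)).choose k : ℚ) (∑ p ∈ _, _), mul_assoc]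
  congr 1
  refine Finset.sum_congr rfl fun p hp => ?_
  have hpi : p ≤ i := Nat.lt_succ_iff.1 (Finset.mem_range.1 hp)
  have : (2 : ℚ) ^ (i + p) = 4 ^ p * 2 ^ (i - p) := by
    rw [show (4 : ℚ) = 2 ^ 2 by norm_num, ← pow_mul, ← pow_add]
    congr 1; omega
  rw [this]; ring

/-- An explicit antiderivative of `1 + 4 V` as an integral series. -/
theorem derivative_uniformized {V : ℤ⟦X⟧} (hV0 : constantCoeff V = 0)
    (hV : V + 3 * V ^ 2 = X * ((1 + 4 * V) ^ 2 * (1 + 2 * V) ^ 2)) :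
    d⁄dX ℤ (-6 * V + X * ((1 + 4 * V) * (7 + 28 * V + 32 * V ^ 2))) = 1 + 4 * V := by
  have hn : ∀ k : ℕ, d⁄dX ℤ (k : ℤ⟦X⟧) = 0 := fun k => Derivation.map_natCast _ k
  have hnum : ∀ k : ℕ, [k.AtLeastTwo] → d⁄dX ℤ (OfNat.ofNat k : ℤ⟦X⟧) = 0 := fun k _ => hn k
  have hd := congrArg (d⁄dX ℤ) hV
  simp only [Derivation.leibniz, derivative_pow, map_add, hnum, smul_eq_mul, derivative_X,
    Derivation.map_one_eq_zero] at hd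
  set D := d⁄dX ℤ V with hD
  push_cast at hd
  set s : ℤ⟦X⟧ := 1 + 6 * V + 8 * V ^ 2 with hs
  have hs0 : s ≠ 0 := by
    intro h
    have := congrArg (constantCoeff (R := ℤ)) h
    simp [hs, hV0] at this
  -- `Q = (1 + 6 V) s - 2 (V + 3 V ^ 2) (6 + 16 V)`. Eliminating `X` between the equation for `V`
  -- and its derivative gives `V' Q = s ^ 3`.
  set Q : ℤ⟦X⟧ := 1 - 24 * V ^ 2 - 48 * V ^ 3 with hQ
  have hQ0 : Q ≠ 0 := by
    intro h
    have := congrArg (constantCoeff (R := ℤ)) h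
    simp [hQ, hV0] at this
  have hDQ : D * Q = s ^ 3 := by
    apply mul_left_cancel₀ hs0
    rw [hQ, hs]
    linear_combination (1 + 6 * V + 8 * V ^ 2) ^ 2 * hd -
      D * (2 * (1 + 6 * V + 8 * V ^ 2) * (6 + 16 * V)) * hV
  have hneg : d⁄dX ℤ (-6 : ℤ⟦X⟧) = 0 := by rw [map_neg, hnum, neg_zero]
  simp only [Derivation.leibniz, derivative_pow, map_add, hnum, hneg, smul_eq_mul, derivative_X,
    Derivation.map_one_eq_zero]
  rw [← hD]
  push_cast
  apply mul_right_cancel₀ (mul_ne_zero (pow_ne_zero 2 hs0) hQ0)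
  rw [hQ, hs] at *
  linear_combination (-6 * (1 + 6 * V + 8 * V ^ 2) ^ 2 + (V + 3 * V ^ 2) *
    (4 * (7 + 28 * V + 32 * V ^ 2) + (1 + 4 * V) * (28 + 64 * V))) * hDQ -
    D * (4 * (7 + 28 * V + 32 * V ^ 2) + (1 + 4 * V) * (28 + 64 * V)) *
      (1 - 24 * V ^ 2 - 48 * V ^ 3) * hV

/-- Each binomial and each power of `2` is at most `4 ^ k`, and both sums have at most `k ≤ 2 ^ k`
terms; `3072 = 2 · 4 · 2 · 4³ · 3`. -/
theorem abs_zetaCoeff_le (k : ℕ) : |zetaCoeff k| ≤ 4 * 3072 ^ k := by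
  rcases Nat.eq_zero_or_pos k with rfl | hk
  · simp [zetaCoeff]
  have hk1 : (1 : ℚ) ≤ k := by exact_mod_cast hk
  have hk2 : (k : ℚ) ≤ 2 ^ k := by exact_mod_cast Nat.lt_two_pow_self.le
  have hch : ∀ a b c : ℕ, a ≤ 2 * c → ((a.choose b : ℕ) : ℚ) ≤ 4 ^ c := by
    intro a b c h
    have : a.choose b ≤ 4 ^ c := (Nat.choose_le_two_pow a b).trans <| by
      rw [show 4 = 2 ^ 2 by norm_num, ← pow_mul]
      exact Nat.pow_le_pow_right (by norm_num) h
    exact_mod_cast this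
  rw [zetaCoeff, abs_mul]
  have h1 : |4 / (k : ℚ)| ≤ 4 := by
    rw [abs_of_nonneg (by positivity)]
    exact div_le_self (by norm_num) hk1
  have hinner : ∀ i ∈ Finset.range k, ∀ p ∈ Finset.range (i + 1),
      ((2 * k).choose p : ℚ) * ((2 * k).choose (i - p) : ℚ) * 2 ^ (i + p) ≤ 4 ^ k * 4 ^ k * 4 ^ k := by
    intro i hi p hp
    rw [Finset.mem_range] at hi hp
    have h2 : (2 : ℚ) ^ (i + p) ≤ 4 ^ k := by
      rw [show (4 : ℚ) = 2 ^ 2 by norm_num, ← pow_mul]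
      exact pow_le_pow_right₀ (by norm_num) (by omega)
    gcongr
    · exact hch _ _ _ le_rfl
    · exact hch _ _ _ le_rfl
  have hmid : ∀ i ∈ Finset.range k, |((2 * k - i - 2).choose (k - 1) : ℚ) *
      (∑ p ∈ Finset.range (i + 1),
        ((2 * k).choose p : ℚ) * ((2 * k).choose (i - p) : ℚ) * 2 ^ (i + p)) *
      (-3) ^ (k - 1 - i)| ≤ 4 ^ k * (2 ^ k * (4 ^ k * 4 ^ k * 4 ^ k)) * 3 ^ k := by
    intro i hi
    have hi' := Finset.mem_range.1 hi
    rw [abs_mul, abs_mul, abs_pow, abs_neg, abs_of_nonneg (by positivity : (0 : ℚ) ≤ 3),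
      abs_of_nonneg (by positivity : (0 : ℚ) ≤ ((2 * k - i - 2).choose (k - 1) : ℚ)),
      abs_of_nonneg (Finset.sum_nonneg fun p _ => by positivity)]
    have hs := Finset.sum_le_card_nsmul _ _ _ (hinner i hi)
    rw [Finset.card_range, nsmul_eq_mul] at hs
    have hik : ((i + 1 : ℕ) : ℚ) ≤ 2 ^ k := le_trans (by exact_mod_cast hi') hk2
    have h3 : (3 : ℚ) ^ (k - 1 - i) ≤ 3 ^ k := pow_le_pow_right₀ (by norm_num) (by omega)
    have hs' : (∑ p ∈ Finset.range (i + 1),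
        ((2 * k).choose p : ℚ) * ((2 * k).choose (i - p) : ℚ) * 2 ^ (i + p)) ≤
          2 ^ k * (4 ^ k * 4 ^ k * 4 ^ k) := hs.trans (by gcongr)
    have hc := hch (2 * k - i - 2) (k - 1) k (by omega)
    gcongr
  have hsum := (Finset.abs_sum_le_sum_abs _ _).trans (Finset.sum_le_card_nsmul _ _ _ hmid)
  rw [Finset.card_range, nsmul_eq_mul] at hsum
  have h3072 : (3072 : ℚ) ^ k = 2 ^ k * (4 ^ k * (2 ^ k * (4 ^ k * 4 ^ k * 4 ^ k)) * 3 ^ k) := by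
    simp only [← mul_pow]; norm_num
  rw [h3072]
  calc _ ≤ 4 * ((k : ℚ) * (4 ^ k * (2 ^ k * (4 ^ k * 4 ^ k * 4 ^ k)) * 3 ^ k)) := by gcongr
    _ ≤ _ := by gcongr

/-- The differential equation `F' = 1 + 4 z F' - 2 F + 6 z F'² - 4 F F'` in coefficients. -/
theorem coeff_recurrence_of_ode {F : ℤ⟦X⟧} (hF0 : coeff 0 F = 0)
    (hF : d⁄dX ℤ F = 1 + 4 * X * d⁄dX ℤ F - 2 * F + 6 * X * (d⁄dX ℤ F) ^ 2 - 4 * F * d⁄dX ℤ F)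
    {l : ℕ} (hl : 1 ≤ l) :
    ((l : ℤ) + 1) * coeff (l + 1) F = 2 * (2 * (l : ℤ) - 1) * coeff l F +
      2 * ∑ i ∈ Finset.range l,
        (3 * (i : ℤ) + 1) * ((l : ℤ) - (i : ℤ)) * coeff (i + 1) F * coeff (l - i) F := by
  obtain ⟨k, rfl⟩ := Nat.exists_eq_add_of_le' hl
  -- Writing `F = X P` puts an `X` on the term `F F'` as well, so both quadratic terms merge into
  -- one convolution. Its left factor `3 F' - 2 P` has coefficients `(3 (i + 1) - 2) p_{i+1}`,
  -- whence `3 i + 1`.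
  obtain ⟨P, hP⟩ : X ∣ F := by rw [X_dvd_iff]; simpa using hF0
  set D := d⁄dX ℤ F with hD
  have hPc : ∀ i, coeff i P = coeff (i + 1) F := fun i => by rw [hP, coeff_succ_X_mul]
  have key : D = 1 + X * (C 4 * D) - C 2 * F + X * (C 2 * ((C 3 * D - C 2 * P) * D)) := by
    have h4 : (C 4 : ℤ⟦X⟧) = 4 := map_ofNat C 4
    have h3 : (C 3 : ℤ⟦X⟧) = 3 := map_ofNat C 3
    have h2 : (C 2 : ℤ⟦X⟧) = 2 := map_ofNat C 2
    rw [h4, h3, h2]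
    linear_combination hF - 4 * D * hP
  have hc := congrArg (coeff (k + 1)) key
  rw [map_add, map_sub, map_add, coeff_succ_X_mul, coeff_succ_X_mul, coeff_C_mul, coeff_C_mul,
    coeff_C_mul, coeff_mul, Finset.Nat.sum_antidiagonal_eq_sum_range_succ_mk, hD,
    coeff_derivative, coeff_derivative, coeff_one, if_neg (Nat.succ_ne_zero k)] at hc
  have hsum : ∑ i ∈ Finset.range (k + 1), (3 * (i : ℤ) + 1) * (((k + 1 : ℕ) : ℤ) - (i : ℤ)) *
      coeff (i + 1) F * coeff (k + 1 - i) F = ∑ i ∈ Finset.range k.succ,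
        coeff i (C 3 * d⁄dX ℤ F - C 2 * P) * coeff (k - i) (d⁄dX ℤ F) := by
    refine Finset.sum_congr rfl fun i hi => ?_
    have hik : i ≤ k := Nat.lt_succ_iff.1 (Finset.mem_range.1 hi)
    rw [map_sub, coeff_C_mul, coeff_C_mul, coeff_derivative, coeff_derivative, hPc,
      show k + 1 - i = k - i + 1 by omega]
    push_cast [hik]
    ring
  rw [hsum]
  push_cast at hc ⊢
  linear_combination hc

/-- Dividing the difference of the two equations by `W - Ω` leaves a cofactor with constant term `-3
· 2 + 2 = -4`, so it is nonzero. -/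
theorem isQuarticRoot_unique {Ω W : ℚ⟦X⟧} (hΩ : IsQuarticRoot Ω) (hΩ0 : constantCoeff Ω = 1)
    (hW : IsQuarticRoot W) (hW0 : constantCoeff W = 1) : W = Ω := by
  unfold IsQuarticRoot at hΩ hW
  have h : (W - Ω) * (4 * X * (W ^ 3 + W ^ 2 * Ω + W * Ω ^ 2 + Ω ^ 3) +
      8 * X * (W ^ 2 + W * Ω + Ω ^ 2) + (4 * X - 3) * (W + Ω) + 2) = 0 := by
    linear_combination hW - hΩ
  rcases mul_eq_zero.1 h with h | h
  · exact sub_eq_zero.1 h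
  · have := congrArg (constantCoeff (R := ℚ)) h
    simp only [map_add, map_mul, map_sub, map_pow, hΩ0, hW0, map_ofNat, constantCoeff_X, map_zero] at this
    norm_num at this

theorem summable_coeff_of_abs_le {f : ℚ⟦X⟧} {B : ℕ} {A : ℚ} (hA : ∀ k, |coeff k f| ≤ A * (B + 1 : ℚ) ^ k)
    {z : ℂ} (hz : ‖z‖ < 1 / (B + 1 : ℝ)) :
    Summable fun k : ℕ => ((coeff k f : ℚ) : ℂ) * z ^ k := by
  have hB : (0 : ℝ) < (B + 1 : ℝ) := by positivity
  have hq : (B + 1 : ℝ) * ‖z‖ < 1 := by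
    rw [lt_div_iff₀ hB] at hz; linarith [mul_comm (B + 1 : ℝ) ‖z‖]
  refine Summable.of_norm_bounded (g := fun k => (A : ℝ) * ((B + 1 : ℝ) * ‖z‖) ^ k)
    ((summable_geometric_of_lt_one (by positivity) hq).mul_left _) fun k => ?_
  have h1 : ‖((coeff k f : ℚ) : ℂ)‖ ≤ (A : ℝ) * (B + 1 : ℝ) ^ k := by
    rw [show ((coeff k f : ℚ) : ℂ) = (((coeff k f : ℚ) : ℝ) : ℂ) by push_cast; rfl, Complex.norm_real,
      Real.norm_eq_abs]
    exact_mod_cast hA k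
  rw [norm_mul, norm_pow, mul_pow, ← mul_assoc]
  gcongr

theorem constantCoeff_omegaSeries : constantCoeff omegaSeries = 1 := by
  rw [← coeff_zero_eq_constantCoeff_apply, omegaSeries, coeff_mk, if_pos rfl]

/-- The algebraic part: the solution of the recurrence, its generating function and the
uniformizing quartic. -/
theorem exists_delay_coefficients : ∃ p : ℕ → ℤ,
      p 1 = 1 ∧
      (∀ l : ℕ, 1 ≤ l →
        ((l : ℤ) + 1) * p (l + 1) = 2 * (2 * (l : ℤ) - 1) * p l +
          2 * ∑ i ∈ Finset.range l,
            (3 * (i : ℤ) + 1) * ((l : ℤ) - (i : ℤ)) * p (i + 1) * p (l - i)) ∧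
      genSeries p = C (3 / 2 : ℚ) - C (3 / 2 : ℚ) * omegaSeries + 2 * X * omegaSeries ^ 3 +
        3 * X * omegaSeries ^ 2 + 2 * X * omegaSeries ∧
      (IsQuarticRoot omegaSeries ∧
        ∀ W : PowerSeries ℚ, IsQuarticRoot W → constantCoeff W = 1 → W = omegaSeries) ∧
      (∀ k : ℕ, 1 ≤ k → ∃ m : ℤ, zetaCoeff k = (m : ℚ)) ∧
      (∃ r : ℝ, 0 < r ∧ ∀ z : ℂ, ‖z‖ < r →
        (Summable fun k : ℕ => ((coeff k omegaSeries : ℚ) : ℂ) * z ^ k) ∧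
        (Summable fun k : ℕ => ((coeff k (genSeries p) : ℚ) : ℂ) * z ^ k)) := by
  obtain ⟨V, hV0, hV⟩ := exists_uniformizer
  set F : ℤ⟦X⟧ := -6 * V + X * ((1 + 4 * V) * (7 + 28 * V + 32 * V ^ 2)) with hF
  have hF' : d⁄dX ℤ F = 1 + 4 * V := derivative_uniformized hV0 hV
  have hF0 : coeff 0 F = 0 := by
    rw [coeff_zero_eq_constantCoeff_apply, hF]; simp [hV0]
  set u : ℚ⟦X⟧ := PowerSeries.map (Int.castRingHom ℚ) V with hu
  have hu0 : constantCoeff u = 0 := by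
    rw [← coeff_zero_eq_constantCoeff_apply, hu, coeff_map, coeff_zero_eq_constantCoeff_apply, hV0]
    simp
  have hu1 : u + 3 * u ^ 2 = X * ((1 + 4 * u) ^ 2 * (1 + 2 * u) ^ 2) := by
    have := congrArg (PowerSeries.map (Int.castRingHom ℚ)) hV
    simpa only [map_add, map_mul, map_pow, map_one, map_ofNat, map_X] using this
  have hζ : ∀ k, zetaCoeff (k + 1) = 4 * coeff (k + 1) u := zetaCoeff_eq_coeff hu0 hu1
  have hΩ : omegaSeries = 1 + 4 * u := by
    have h4 : (4 : ℚ⟦X⟧) = C 4 := (map_ofNat C 4).symm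
    ext k
    rw [omegaSeries, coeff_mk, map_add, h4, coeff_C_mul, coeff_one]
    rcases k with _ | k
    · rw [coeff_zero_eq_constantCoeff_apply, hu0]; simp
    · rw [if_neg (Nat.succ_ne_zero k), if_neg (Nat.succ_ne_zero k), hζ, zero_add]
  have hquart : IsQuarticRoot omegaSeries := by
    unfold IsQuarticRoot
    rw [hΩ]
    linear_combination -16 * hu1
  have hgen : genSeries (fun l => coeff l F) = PowerSeries.map (Int.castRingHom ℚ) F := by
    ext k
    rw [genSeries, coeff_mk, coeff_map]
    rcases k with _ | k
    · simp [hF0]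
    · simp
  -- `F' = Ω`, so the bound on the coefficients of `Ω` passes to `F`.
  have hgen' : ∀ k : ℕ, ((k : ℚ) + 1) * coeff (k + 1) (genSeries (fun l => coeff l F)) =
      coeff k omegaSeries := by
    intro k
    have h := congrArg (PowerSeries.map (Int.castRingHom ℚ)) hF'
    have h1 : PowerSeries.map (Int.castRingHom ℚ) (1 + 4 * V) = omegaSeries := by
      rw [hΩ, map_add, map_mul, map_one, map_ofNat]
    rw [h1] at h
    rw [← h, hgen, coeff_map, coeff_map, coeff_derivative]
    simp [mul_comm]
  have hΩb : ∀ k, |coeff k omegaSeries| ≤ 4 * ((3071 : ℕ) + 1 : ℚ) ^ k := by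
    intro k
    have h : ((3071 : ℕ) + 1 : ℚ) = 3072 := by norm_num
    rw [omegaSeries, coeff_mk, h]
    split_ifs with hk
    · subst hk; norm_num
    · exact abs_zetaCoeff_le k
  have hFb : ∀ k, |coeff k (genSeries (fun l => coeff l F))| ≤ 4 * ((3071 : ℕ) + 1 : ℚ) ^ k := by
    intro k
    rcases k with _ | k
    · simp [genSeries]
    · have h1 : (1 : ℚ) ≤ (k : ℚ) + 1 := by linarith [(Nat.cast_nonneg k : (0 : ℚ) ≤ k)]
      have h2 := congrArg abs (hgen' k)
      rw [abs_mul, abs_of_nonneg (by linarith : (0 : ℚ) ≤ (k : ℚ) + 1)] at h2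
      calc _ ≤ ((k : ℚ) + 1) * |coeff (k + 1) (genSeries (fun l => coeff l F))| :=
            le_mul_of_one_le_left (abs_nonneg _) h1
        _ ≤ 4 * ((3071 : ℕ) + 1 : ℚ) ^ k := h2 ▸ hΩb k
        _ ≤ _ := by
          gcongr
          · norm_num
          · omega
  refine ⟨fun l => coeff l F, ?_, fun l hl => ?_, ?_, ⟨hquart, fun W hW hW0 => ?_⟩, fun k hk => ?_,
    1 / ((3071 : ℕ) + 1 : ℝ), by positivity, fun z hz => ⟨?_, ?_⟩⟩
  · have := congrArg (coeff 0) hF'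
    rw [coeff_derivative] at this
    simpa [hV0] using this
  · refine coeff_recurrence_of_ode hF0 ?_ hl
    rw [hF', hF]
    linear_combination (-32) * hV
  · have h2 : (C (3 / 2) : ℚ⟦X⟧) - C (3 / 2) * omegaSeries = -6 * u := by
      have h4 : (4 : ℚ⟦X⟧) = C 4 := (map_ofNat C 4).symm
      have h6 : (6 : ℚ⟦X⟧) = C (3 / 2) * C 4 := by
        rw [← map_mul, show (3 / 2 * 4 : ℚ) = 6 by norm_num]
        exact (map_ofNat C 6).symm
      rw [hΩ, h6, h4]; ring
    rw [hgen, hF, h2, hΩ]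
    simp only [map_add, map_mul, map_pow, map_one, map_ofNat, map_X, map_neg]
    rw [← hu]; ring
  · exact isQuarticRoot_unique hquart constantCoeff_omegaSeries hW hW0
  · obtain ⟨j, rfl⟩ := Nat.exists_eq_add_of_le' hk
    refine ⟨4 * coeff (j + 1) V, ?_⟩
    rw [hζ, hu, coeff_map]; simp
  · exact summable_coeff_of_abs_le hΩb hz
  · exact summable_coeff_of_abs_le hFb hz

/-! ### Alternating functions of exponents and the power-sum operators -/

section Alternating

/-- A function of tuples of exponents that changes sign under transpositions. -/
def IsAlternatingFun {ι : Type*} [DecidableEq ι] (G : (ι → ℕ) → ℝ) : Prop :=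
  ∀ (e : ι → ℕ) (i j : ι), i ≠ j → G (e ∘ Equiv.swap i j) = -G e

theorem IsAlternatingFun.eq_zero {ι : Type*} [DecidableEq ι] {G : (ι → ℕ) → ℝ} (hG : IsAlternatingFun G) {e : ι → ℕ} {i j : ι}
    (hij : i ≠ j) (he : e i = e j) : G e = 0 := by
  have h := hG e i j hij
  have : e ∘ Equiv.swap i j = e := by
    ext a
    simp only [Function.comp, Equiv.swap_apply_def]
    split_ifs with h1 h2
    · rw [h1, he]
    · rw [h2, he]
    · rfl
  rw [this] at h
  linarith

variable {ι : Type*} [Fintype ι] [DecidableEq ι]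

/-- The action of the power sum `pₖ` on functions of exponents. -/
def shiftSum (k : ℕ) (G : (ι → ℕ) → ℝ) (e : ι → ℕ) : ℝ :=
  ∑ i, G (e + Pi.single i k)

theorem IsAlternatingFun.isAlternatingFun_shiftSum {G : (ι → ℕ) → ℝ} (hG : IsAlternatingFun G) (k : ℕ) :
    IsAlternatingFun (shiftSum k G) := by
  intro e i j hij
  unfold shiftSum
  rw [← Finset.sum_neg_distrib, ← Equiv.sum_comp (Equiv.swap i j)]
  refine Finset.sum_congr rfl fun a _ => ?_
  rw [← hG _ i j hij]
  congr 1
  ext b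
  simp only [Function.comp, Pi.add_apply, Pi.single_apply]
  congr 1
  simp only [← Equiv.swap_apply_eq_iff]

theorem shiftSum_comm (k l : ℕ) (G : (ι → ℕ) → ℝ) (e : ι → ℕ) :
    shiftSum k (shiftSum l G) e = shiftSum l (shiftSum k G) e := by
  unfold shiftSum
  rw [Finset.sum_comm]
  refine Finset.sum_congr rfl fun a _ => Finset.sum_congr rfl fun b _ => ?_
  rw [add_right_comm]

end Alternating

/-! ### Hankel-type minors -/

section Minors

variable {ι : Type*} [Fintype ι] [DecidableEq ι]

/-- Both sides are the trace of `adjugate A * B`, the derivative of the determinant in the direction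
`B`. -/
theorem Matrix.sum_det_updateRow_eq_sum_det_updateCol (A B : Matrix ι ι ℝ) :
    ∑ i, (A.updateRow i (B i)).det = ∑ j, (A.updateCol j fun i => B i j).det := by
  have hcol : ∀ j, (A.updateCol j fun i => B i j).det = ∑ i, A.adjugate j i * B i j := by
    intro j
    rw [← Matrix.cramer_apply, Matrix.cramer_eq_adjugate_mulVec]
    rfl
  have hrow : ∀ i, (A.updateRow i (B i)).det = ∑ j, A.adjugate j i * B i j := by
    intro i
    rw [← Matrix.det_transpose, ← Matrix.updateCol_transpose, ← Matrix.cramer_apply,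
      Matrix.cramer_eq_adjugate_mulVec, ← Matrix.adjugate_transpose]
    rfl
  simp only [hcol, hrow]
  exact Finset.sum_comm

/-- The three-term Plücker relation. -/
theorem Matrix.plucker_relation (A : Matrix ι ι ℝ) {p q : ι} (hpq : p ≠ q) (u v w x : ι → ℝ) :
    ((A.updateCol p u).updateCol q v).det * ((A.updateCol p w).updateCol q x).det -
      ((A.updateCol p u).updateCol q w).det * ((A.updateCol p v).updateCol q x).det +
      ((A.updateCol p u).updateCol q x).det * ((A.updateCol p v).updateCol q w).det = 0 := by
  set M := (A.updateCol p u).updateCol q v with hM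
  have hlin : ∀ y, ((A.updateCol p y).updateCol q x).det = (A.updateCol q x).cramer y p := by
    intro y
    rw [Matrix.cramer_apply, Matrix.updateCol_comm _ hpq]
  -- Cramer's rule expands `w` in the columns of `M`. Put into slot `p`, every column other than `p`
  -- and `q` repeats a column already present, so two terms remain.
  have hw : M.det • w = ∑ i, M.cramer w i • M.col i := by
    rw [← Matrix.mulVec_cramer, Matrix.mulVec_eq_sum]
    refine Finset.sum_congr rfl fun i _ => ?_
    rw [op_smul_eq_smul]
    rfl
  have h1 : M.det * ((A.updateCol p w).updateCol q x).det =
      ∑ i, M.cramer w i * ((A.updateCol p (M.col i)).updateCol q x).det := by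
    rw [hlin, ← smul_eq_mul, ← Pi.smul_apply, ← map_smul, hw, map_sum, Finset.sum_apply]
    refine Finset.sum_congr rfl fun i _ => ?_
    rw [map_smul, Pi.smul_apply, smul_eq_mul, hlin]
  have hz : ∀ i, i ≠ p → i ≠ q →
      M.cramer w i * ((A.updateCol p (M.col i)).updateCol q x).det = 0 := by
    intro i hip hiq
    rw [Matrix.det_zero_of_column_eq hip, mul_zero]
    intro k
    simp [hM, hip, hiq, hpq, Matrix.col]
  rw [← Finset.sum_subset (Finset.subset_univ {p, q}), Finset.sum_pair hpq] at h1
  · have hp : M.cramer w p = -((A.updateCol p v).updateCol q w).det := by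
      rw [Matrix.cramer_apply, hM, Matrix.updateCol_comm _ hpq.symm, Matrix.updateCol_idem]
      have h := Matrix.det_permute' (Equiv.swap p q) ((A.updateCol p v).updateCol q w)
      rw [Equiv.Perm.sign_swap hpq] at h
      have hs : ((A.updateCol p v).updateCol q w).submatrix id (Equiv.swap p q) =
          (A.updateCol p w).updateCol q v := by
        ext a c
        simp only [Matrix.submatrix_apply, Matrix.updateCol_apply, Equiv.swap_apply_def, id]
        split_ifs <;> simp_all
      rw [hs] at h
      rw [h]; simp
    have hq : M.cramer w q = ((A.updateCol p u).updateCol q w).det := by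
      rw [Matrix.cramer_apply, hM, Matrix.updateCol_idem]
    have hcp : M.col p = u := by
      ext k; simp [hM, Matrix.col, hpq]
    have hcq : M.col q = v := by
      ext k; simp [hM, Matrix.col]
    rw [hp, hq, hcp, hcq] at h1
    linear_combination h1
  · intro i _ hi
    simp only [Finset.mem_insert, Finset.mem_singleton, not_or] at hi
    exact hz i hi.1 hi.2

/-- The minor of the Hankel matrix of `μ` with rows `e` and columns `f`. -/
def hankelMinor (μ : ℕ → ℝ) (e f : ι → ℕ) : ℝ :=
  (Matrix.of fun i j => μ (e i + f j)).det

theorem hankelMinor_comm (μ : ℕ → ℝ) (e f : ι → ℕ) : hankelMinor μ e f = hankelMinor μ f e := by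
  unfold hankelMinor
  rw [← Matrix.det_transpose]
  congr 1
  ext i j
  simp [add_comm]

theorem isAlternatingFun_hankelMinor (μ : ℕ → ℝ) (f : ι → ℕ) :
    IsAlternatingFun fun e => hankelMinor μ e f := by
  intro e i j hij
  have h := Matrix.det_permute (Equiv.swap i j) (Matrix.of fun i j => μ (e i + f j))
  rw [Equiv.Perm.sign_swap hij] at h
  have hs : (Matrix.of fun a b => μ (e a + f b)).submatrix (Equiv.swap i j) id =
      Matrix.of fun a b => μ ((e ∘ Equiv.swap i j) a + f b) := rfl
  rw [hs] at h
  simpa [hankelMinor] using h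

theorem hankelMinor_add_single_left (μ : ℕ → ℝ) (e f : ι → ℕ) (i : ι) (k : ℕ) :
    hankelMinor μ (e + Pi.single i k) f =
      ((Matrix.of fun i j => μ (e i + f j)).updateRow i fun j => μ (e i + f j + k)).det := by
  unfold hankelMinor
  congr 1
  ext a b
  by_cases h : a = i
  · subst h; simp [add_right_comm]
  · simp [h]

theorem hankelMinor_add_single_right (μ : ℕ → ℝ) (e f : ι → ℕ) (j : ι) (k : ℕ) :
    hankelMinor μ e (f + Pi.single j k) =
      ((Matrix.of fun i j => μ (e i + f j)).updateCol j fun i => μ (e i + f j + k)).det := by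
  unfold hankelMinor
  congr 1
  ext a b
  by_cases h : b = j
  · subst h; simp [add_assoc]
  · simp [h]

/-- The entries depend only on `e i + f j`, so raising a row exponent or a column exponent is the
same perturbation of the matrix. -/
theorem shiftSum_hankelMinor_comm (μ : ℕ → ℝ) (e f : ι → ℕ) (k : ℕ) :
    shiftSum k (fun e => hankelMinor μ e f) e = shiftSum k (fun f => hankelMinor μ e f) f := by
  unfold shiftSum
  simp only [hankelMinor_add_single_left, hankelMinor_add_single_right]
  exact Matrix.sum_det_updateRow_eq_sum_det_updateCol _ (fun i j => μ (e i + f j + k))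

/-- The Virasoro constraints, for moments with a three-term linear relation. -/
theorem virasoro_hankelMinor {μ : ℕ → ℝ} {z b : ℝ} {e f : ι → ℕ} {k : ℕ}
    (h : ∀ i j, z * μ (e i + f j + k + 2) + ((e i + f j + k : ℕ) + 2 - b) * μ (e i + f j + k + 1) +
      μ (e i + f j + k) = 0) :
    z * shiftSum (k + 2) (fun e => hankelMinor μ e f) e + shiftSum k (fun e => hankelMinor μ e f) e +
      ∑ i, ((e i : ℝ) + k + 2 - b) * hankelMinor μ (e + Pi.single i (k + 1)) f +
      ∑ j, (f j : ℝ) * hankelMinor μ e (f + Pi.single j (k + 1)) = 0 := by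
  set A := Matrix.of fun i j => μ (e i + f j) with hA
  -- Moving the column sum to the rows lets the weights `e i` and `f j` combine into `e i + f j`;
  -- the replaced row is then the three-term relation, which vanishes.
  have hcol : ∑ j, (f j : ℝ) * hankelMinor μ e (f + Pi.single j (k + 1)) =
      ∑ i, (A.updateRow i fun j => (f j : ℝ) * μ (e i + f j + (k + 1))).det := by
    rw [Matrix.sum_det_updateRow_eq_sum_det_updateCol A
      (fun i j => (f j : ℝ) * μ (e i + f j + (k + 1)))]
    refine Finset.sum_congr rfl fun j _ => ?_
    rw [hankelMinor_add_single_right, ← Matrix.det_updateCol_smul]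
    rfl
  rw [hcol]
  unfold shiftSum
  rw [Finset.mul_sum, ← Finset.sum_add_distrib, ← Finset.sum_add_distrib, ← Finset.sum_add_distrib]
  refine Finset.sum_eq_zero fun i _ => ?_
  simp only [hankelMinor_add_single_left]
  rw [← Matrix.det_updateRow_smul, ← Matrix.det_updateRow_smul, ← Matrix.det_updateRow_add,
    ← Matrix.det_updateRow_add, ← Matrix.det_updateRow_add]
  refine Matrix.det_eq_zero_of_row_eq_zero i fun j => ?_
  rw [Matrix.updateRow_self]
  have := h i j
  simp only [Pi.add_apply, Pi.smul_apply, smul_eq_mul]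
  push_cast at this
  simp only [← add_assoc]
  linear_combination this

end Minors

/-! ### The top four exponents -/

section TopFour

/-- The exponents `0, …, N - 1` together with `N + a, N + b, N + c, N + d`. -/
def topFour (N a b c d : ℕ) : Fin N ⊕ Fin 4 → ℕ :=
  Sum.elim (fun i => (i : ℕ)) (fun j => N + ![a, b, c, d] j)

variable {N : ℕ} {G : (Fin N ⊕ Fin 4 → ℕ) → ℝ}

/-- A low exponent raised by `k` lands on another low exponent or on some `N + r` with `r < k`. The
hypothesis says that those places are occupied, so alternation kills the term. -/
theorem IsAlternatingFun.sum_mul_shift (hG : IsAlternatingFun G) (w : Fin N ⊕ Fin 4 → ℝ) {k : ℕ}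
    (hk : 0 < k) {a b c d : ℕ} (h : ∀ r < k, r = a ∨ r = b ∨ r = c ∨ r = d) :
    ∑ i, w i * G (topFour N a b c d + Pi.single i k) =
      w (Sum.inr 0) * G (topFour N (a + k) b c d) + w (Sum.inr 1) * G (topFour N a (b + k) c d) +
      w (Sum.inr 2) * G (topFour N a b (c + k) d) + w (Sum.inr 3) * G (topFour N a b c (d + k)) := by
  rw [Fintype.sum_sum_type, Finset.sum_eq_zero, zero_add, Fin.sum_univ_four]
  · have hs : ∀ (j : Fin 4) (a' b' c' d' : ℕ),
        (![a', b', c', d'] : Fin 4 → ℕ) = ![a, b, c, d] + Pi.single j k →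
        topFour N a b c d + Pi.single (Sum.inr j) k = topFour N a' b' c' d' := by
      intro j a' b' c' d' hv
      ext (i | i)
      · simp [topFour]
      · simp only [topFour, Pi.add_apply, Sum.elim_inr, hv, Pi.single_apply, Sum.inr.injEq, add_assoc]
    rw [hs 0 (a + k) b c d, hs 1 a (b + k) c d, hs 2 a b (c + k) d, hs 3 a b c (d + k)]
    all_goals ext i; fin_cases i <;> simp
  · intro i _
    have hi := i.2
    suffices hz : G (topFour N a b c d + Pi.single (Sum.inl i) k) = 0 by rw [hz, mul_zero]
    by_cases hik : (i : ℕ) + k < N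
    · have hne : (i : Fin N) ≠ ⟨i + k, hik⟩ := by
        intro he
        have := congrArg Fin.val he
        simp at this
        omega
      refine hG.eq_zero (i := Sum.inl i) (j := Sum.inl ⟨i + k, hik⟩) (by simpa using hne) ?_
      simp [topFour, hne.symm]
    · have hr : ∃ j : Fin 4, ![a, b, c, d] j = i + k - N := by
        rcases h (i + k - N) (by omega) with h | h | h | h
        · exact ⟨0, by simp [h]⟩
        · exact ⟨1, by simp [h]⟩
        · exact ⟨2, by simp [h]⟩
        · exact ⟨3, by simp [h]⟩
      obtain ⟨j, hj⟩ := hr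
      refine hG.eq_zero (i := Sum.inl i) (j := Sum.inr j) (by simp) ?_
      simp only [topFour, Pi.add_apply, Sum.elim_inl, Sum.elim_inr, Pi.single_apply, hj, if_true,
        reduceCtorEq, if_false]
      omega

theorem IsAlternatingFun.shiftSum_topFour (hG : IsAlternatingFun G) {k : ℕ}
    (hk : 0 < k) {a b c d : ℕ} (h : ∀ r < k, r = a ∨ r = b ∨ r = c ∨ r = d) :
    shiftSum k G (topFour N a b c d) =
      G (topFour N (a + k) b c d) + G (topFour N a (b + k) c d) +
      G (topFour N a b (c + k) d) + G (topFour N a b c (d + k)) := by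
  have := hG.sum_mul_shift (fun _ => 1) hk h
  simpa [shiftSum] using this

theorem IsAlternatingFun.topFour_eq_zero (hG : IsAlternatingFun G) {a b c d : ℕ}
    (h : a = b ∨ a = c ∨ a = d ∨ b = c ∨ b = d ∨ c = d) : G (topFour N a b c d) = 0 := by
  rcases h with h | h | h | h | h | h
  · exact hG.eq_zero (i := Sum.inr 0) (j := Sum.inr 1) (by simp) (by simp [topFour, h])
  · exact hG.eq_zero (i := Sum.inr 0) (j := Sum.inr 2) (by simp) (by simp [topFour, h])
  · exact hG.eq_zero (i := Sum.inr 0) (j := Sum.inr 3) (by simp) (by simp [topFour, h])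
  · exact hG.eq_zero (i := Sum.inr 1) (j := Sum.inr 2) (by simp) (by simp [topFour, h])
  · exact hG.eq_zero (i := Sum.inr 1) (j := Sum.inr 3) (by simp) (by simp [topFour, h])
  · exact hG.eq_zero (i := Sum.inr 2) (j := Sum.inr 3) (by simp) (by simp [topFour, h])

theorem IsAlternatingFun.topFour_swap (hG : IsAlternatingFun G) (a b c d : ℕ) :
    G (topFour N b a c d) = -G (topFour N a b c d) ∧ G (topFour N a c b d) = -G (topFour N a b c d) ∧
      G (topFour N a b d c) = -G (topFour N a b c d) := by
  refine ⟨?_, ?_, ?_⟩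
  · rw [← hG _ (Sum.inr 0) (Sum.inr 1) (by simp)]
    congr 1; ext (i | i)
    · simp [topFour, Equiv.swap_apply_def]
    · fin_cases i <;> simp [topFour, Equiv.swap_apply_def]
  · rw [← hG _ (Sum.inr 1) (Sum.inr 2) (by simp)]
    congr 1; ext (i | i)
    · simp [topFour, Equiv.swap_apply_def]
    · fin_cases i <;> simp [topFour, Equiv.swap_apply_def]
  · rw [← hG _ (Sum.inr 2) (Sum.inr 3) (by simp)]
    congr 1; ext (i | i)
    · simp [topFour, Equiv.swap_apply_def]
    · fin_cases i <;> simp [topFour, Equiv.swap_apply_def]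

/-- For `a < b < c < d`, the value at `topFour N a b c d` plays the role of the Schur function of
the partition `(d - 3, c - 2, b - 1, a)`. Under this reading, this and the next six lemmas are
Pieri's rule for adding one box. -/
theorem IsAlternatingFun.shiftSum_one_0123 (hG : IsAlternatingFun G) :
    shiftSum 1 G (topFour N 0 1 2 3) = G (topFour N 0 1 2 4) := by
  rw [hG.shiftSum_topFour one_pos (by omega)]
  simp only [Nat.reduceAdd]
  rw [hG.topFour_eq_zero (a := 1) (by omega),
    hG.topFour_eq_zero (b := 2) (by omega), hG.topFour_eq_zero (c := 3) (by omega)]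
  ring

theorem IsAlternatingFun.shiftSum_one_0124 (hG : IsAlternatingFun G) :
    shiftSum 1 G (topFour N 0 1 2 4) = G (topFour N 0 1 2 5) + G (topFour N 0 1 3 4) := by
  rw [hG.shiftSum_topFour one_pos (by omega)]
  simp only [Nat.reduceAdd]
  rw [hG.topFour_eq_zero (a := 1) (by omega),
    hG.topFour_eq_zero (b := 2) (by omega)]
  ring

theorem IsAlternatingFun.shiftSum_one_0125 (hG : IsAlternatingFun G) :
    shiftSum 1 G (topFour N 0 1 2 5) = G (topFour N 0 1 2 6) + G (topFour N 0 1 3 5) := by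
  rw [hG.shiftSum_topFour one_pos (by omega)]
  simp only [Nat.reduceAdd]
  rw [hG.topFour_eq_zero (a := 1) (by omega),
    hG.topFour_eq_zero (b := 2) (by omega)]
  ring

theorem IsAlternatingFun.shiftSum_one_0134 (hG : IsAlternatingFun G) :
    shiftSum 1 G (topFour N 0 1 3 4) = G (topFour N 0 1 3 5) + G (topFour N 0 2 3 4) := by
  rw [hG.shiftSum_topFour one_pos (by omega)]
  simp only [Nat.reduceAdd]
  rw [hG.topFour_eq_zero (a := 1) (by omega),
    hG.topFour_eq_zero (c := 4) (by omega)]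
  ring

theorem IsAlternatingFun.shiftSum_one_0126 (hG : IsAlternatingFun G) :
    shiftSum 1 G (topFour N 0 1 2 6) = G (topFour N 0 1 2 7) + G (topFour N 0 1 3 6) := by
  rw [hG.shiftSum_topFour one_pos (by omega)]
  simp only [Nat.reduceAdd]
  rw [hG.topFour_eq_zero (a := 1) (by omega),
    hG.topFour_eq_zero (b := 2) (by omega)]
  ring

theorem IsAlternatingFun.shiftSum_one_0135 (hG : IsAlternatingFun G) :
    shiftSum 1 G (topFour N 0 1 3 5) =
      G (topFour N 0 1 3 6) + G (topFour N 0 1 4 5) + G (topFour N 0 2 3 5) := by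
  rw [hG.shiftSum_topFour one_pos (by omega)]
  simp only [Nat.reduceAdd]
  rw [hG.topFour_eq_zero (a := 1) (by omega)]
  ring

theorem IsAlternatingFun.shiftSum_one_0234 (hG : IsAlternatingFun G) :
    shiftSum 1 G (topFour N 0 2 3 4) = G (topFour N 0 2 3 5) + G (topFour N 1 2 3 4) := by
  rw [hG.shiftSum_topFour one_pos (by omega)]
  simp only [Nat.reduceAdd]
  rw [hG.topFour_eq_zero (b := 3) (by omega),
    hG.topFour_eq_zero (c := 4) (by omega)]
  ring

/-- Here and for the other `p₂` and `p₃` actions, the rule is Murnaghan–Nakayama: border strips are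
added, with signs from re-sorting the exponents. -/
theorem IsAlternatingFun.shiftSum_two_0123 (hG : IsAlternatingFun G) :
    shiftSum 2 G (topFour N 0 1 2 3) = G (topFour N 0 1 2 5) - G (topFour N 0 1 3 4) := by
  rw [hG.shiftSum_topFour two_pos (by omega)]
  simp only [Nat.reduceAdd]
  rw [hG.topFour_eq_zero (a := 2) (by omega),
    hG.topFour_eq_zero (b := 3) (by omega), (hG.topFour_swap 0 1 3 4).2.2]
  ring

theorem IsAlternatingFun.shiftSum_two_0125 (hG : IsAlternatingFun G) :
    shiftSum 2 G (topFour N 0 1 2 5) =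
      G (topFour N 0 1 2 7) + G (topFour N 0 1 4 5) - G (topFour N 0 2 3 5) := by
  rw [hG.shiftSum_topFour two_pos (by omega)]
  simp only [Nat.reduceAdd]
  rw [hG.topFour_eq_zero (a := 2) (by omega),
    (hG.topFour_swap 0 2 3 5).2.1]
  ring

theorem IsAlternatingFun.shiftSum_two_0134 (hG : IsAlternatingFun G) :
    shiftSum 2 G (topFour N 0 1 3 4) =
      G (topFour N 0 1 3 6) - G (topFour N 0 1 4 5) - G (topFour N 1 2 3 4) := by
  rw [hG.shiftSum_topFour two_pos (by omega)]
  simp only [Nat.reduceAdd]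
  rw [hG.topFour_eq_zero (b := 3) (by omega),
    (hG.topFour_swap 1 2 3 4).1, (hG.topFour_swap 0 1 4 5).2.2]
  ring

theorem IsAlternatingFun.shiftSum_three_0123 (hG : IsAlternatingFun G) :
    shiftSum 3 G (topFour N 0 1 2 3) =
      G (topFour N 0 1 2 6) - G (topFour N 0 1 3 5) + G (topFour N 0 2 3 4) := by
  rw [hG.shiftSum_topFour three_pos (by omega)]
  simp only [Nat.reduceAdd]
  rw [hG.topFour_eq_zero (a := 3) (by omega),
    (hG.topFour_swap 0 1 3 5).2.2, (hG.topFour_swap 0 2 4 3).2.1, (hG.topFour_swap 0 2 3 4).2.2]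
  ring

/-- The power-sum expansions of the Schur functions `s₁₁`, `s₂`, `s₂₁` and `s₂₂`. -/
theorem IsAlternatingFun.schur_power_sum (hG : IsAlternatingFun G) :
    shiftSum 1 (shiftSum 1 G) (topFour N 0 1 2 3) + shiftSum 2 G (topFour N 0 1 2 3) =
        2 * G (topFour N 0 1 2 5) ∧
      shiftSum 1 (shiftSum 1 G) (topFour N 0 1 2 3) - shiftSum 2 G (topFour N 0 1 2 3) =
        2 * G (topFour N 0 1 3 4) ∧
      shiftSum 1 (shiftSum 1 (shiftSum 1 G)) (topFour N 0 1 2 3) -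
        shiftSum 3 G (topFour N 0 1 2 3) = 3 * G (topFour N 0 1 3 5) ∧
      shiftSum 1 (shiftSum 1 (shiftSum 1 (shiftSum 1 G))) (topFour N 0 1 2 3) +
        3 * shiftSum 2 (shiftSum 2 G) (topFour N 0 1 2 3) -
        4 * shiftSum 3 (shiftSum 1 G) (topFour N 0 1 2 3) = 12 * G (topFour N 0 1 4 5) := by
  have h1 := hG.isAlternatingFun_shiftSum 1
  have h11 := h1.isAlternatingFun_shiftSum 1
  have h111 := h11.isAlternatingFun_shiftSum 1
  have h2 := hG.isAlternatingFun_shiftSum 2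
  refine ⟨?_, ?_, ?_, ?_⟩
  · rw [h1.shiftSum_one_0123, hG.shiftSum_one_0124, hG.shiftSum_two_0123]; ring
  · rw [h1.shiftSum_one_0123, hG.shiftSum_one_0124, hG.shiftSum_two_0123]; ring
  · rw [h11.shiftSum_one_0123, h1.shiftSum_one_0124, hG.shiftSum_one_0125, hG.shiftSum_one_0134,
      hG.shiftSum_three_0123]
    ring
  · rw [h111.shiftSum_one_0123, h11.shiftSum_one_0124, h1.shiftSum_one_0125, h1.shiftSum_one_0134,
      hG.shiftSum_one_0126, hG.shiftSum_one_0135, hG.shiftSum_one_0234, h2.shiftSum_two_0123,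
      hG.shiftSum_two_0125, hG.shiftSum_two_0134, h1.shiftSum_three_0123, hG.shiftSum_one_0126,
      hG.shiftSum_one_0135, hG.shiftSum_one_0234]
    ring

/-- The Plücker relation for columns `N + 2, …, N + 5`; in Schur functions, `s_∅ s₂₂ - s₁ s₂₁ + s₂
s₁₁ = 0`, the first KP equation. -/
theorem hankelMinor_plucker (μ : ℕ → ℝ) (e : Fin N ⊕ Fin 4 → ℕ) :
    hankelMinor μ e (topFour N 0 1 2 3) * hankelMinor μ e (topFour N 0 1 4 5) -
      hankelMinor μ e (topFour N 0 1 2 4) * hankelMinor μ e (topFour N 0 1 3 5) +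
      hankelMinor μ e (topFour N 0 1 2 5) * hankelMinor μ e (topFour N 0 1 3 4) = 0 := by
  set A : Matrix (Fin N ⊕ Fin 4) (Fin N ⊕ Fin 4) ℝ :=
    Matrix.of fun i j => μ (e i + topFour N 0 1 2 3 j)
  have h : ∀ c d, hankelMinor μ e (topFour N 0 1 c d) =
      ((A.updateCol (Sum.inr 2) fun i => μ (e i + (N + c))).updateCol (Sum.inr 3)
        fun i => μ (e i + (N + d))).det := by
    intro c d
    unfold hankelMinor
    congr 1
    ext i (j | j)
    · simp [A, topFour]
    · fin_cases j <;> simp [A, topFour]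
  simp only [h]
  exact Matrix.plucker_relation A (by simp) _ _ _ _

end TopFour

/-! ### Virasoro constraints for the standard minor and elimination of `p₂`, `p₃` -/

section Bilinear

variable {N : ℕ}

theorem isAlternatingFun_hankelMinor_right (μ : ℕ → ℝ) (e : Fin N ⊕ Fin 4 → ℕ) :
    IsAlternatingFun fun f => hankelMinor μ e f := by
  have := isAlternatingFun_hankelMinor μ e
  simpa only [hankelMinor_comm μ _ e] using this

theorem IsAlternatingFun.sum_mul_shift_one {G : (Fin N ⊕ Fin 4 → ℕ) → ℝ} (hG : IsAlternatingFun G)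
    (w : Fin N ⊕ Fin 4 → ℝ) :
    ∑ i, w i * G (topFour N 0 1 2 3 + Pi.single i 1) =
      w (Sum.inr 3) * shiftSum 1 G (topFour N 0 1 2 3) := by
  rw [hG.sum_mul_shift w one_pos (by omega), hG.shiftSum_one_0123]
  simp only [Nat.reduceAdd]
  rw [hG.topFour_eq_zero (a := 1) (by omega), hG.topFour_eq_zero (b := 2) (by omega),
    hG.topFour_eq_zero (c := 3) (by omega)]
  ring

theorem IsAlternatingFun.sum_mul_shift_two {G : (Fin N ⊕ Fin 4 → ℕ) → ℝ} (hG : IsAlternatingFun G)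
    (w : Fin N ⊕ Fin 4 → ℝ) :
    ∑ i, w i * G (topFour N 0 1 2 3 + Pi.single i 2) =
      w (Sum.inr 3) * G (topFour N 0 1 2 5) - w (Sum.inr 2) * G (topFour N 0 1 3 4) := by
  rw [hG.sum_mul_shift w two_pos (by omega)]
  simp only [Nat.reduceAdd]
  rw [hG.topFour_eq_zero (a := 2) (by omega), hG.topFour_eq_zero (b := 3) (by omega),
    (hG.topFour_swap 0 1 3 4).2.2]
  ring

theorem topFour_le (i : Fin N ⊕ Fin 4) : topFour N 0 1 2 3 i ≤ N + 3 := by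
  rcases i with i | i
  · simp only [topFour, Sum.elim_inl]; omega
  · fin_cases i <;> simp [topFour]

theorem topFour_inr_three : (topFour N 0 1 2 3 (Sum.inr 3) : ℝ) = N + 3 := by
  simp [topFour]

theorem topFour_inr_two : (topFour N 0 1 2 3 (Sum.inr 2) : ℝ) = N + 2 := by
  simp [topFour]

theorem shiftSum_zero {ι : Type*} [Fintype ι] [DecidableEq ι] (G : (ι → ℕ) → ℝ) (e : ι → ℕ) :
    shiftSum 0 G e = Fintype.card ι * G e := by
  simp [shiftSum]

/-- The derivative of a sum over shifts with exponent-dependent weights. -/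
theorem sum_shift_weighted {ι : Type*} [Fintype ι] [DecidableEq ι] (G : (ι → ℕ) → ℝ) (e : ι → ℕ)
    (m k : ℕ) (c : ℝ) :
    ∑ a, ∑ i, ((((e + Pi.single a m : ι → ℕ) i : ℕ) : ℝ) + c) * G (e + Pi.single a m + Pi.single i k) =
      ∑ i, ((e i : ℝ) + c) * shiftSum m G (e + Pi.single i k) + m * shiftSum (m + k) G e := by
  have h : ∀ a i, ((((e + Pi.single a m : ι → ℕ) i : ℕ) : ℝ) + c) * G (e + Pi.single a m + Pi.single i k) =
      ((e i : ℝ) + c) * G (e + Pi.single i k + Pi.single a m) +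
        if i = a then (m : ℝ) * G (e + Pi.single a (m + k)) else 0 := by
    intro a i
    rw [add_right_comm e (Pi.single i k)]
    by_cases hia : i = a
    · subst hia
      rw [if_pos rfl, Pi.single_add, ← add_assoc]
      simp only [Pi.add_apply, Pi.single_eq_same]
      push_cast; ring
    · simp [hia]
  simp only [h, Finset.sum_add_distrib, Finset.sum_ite_eq', Finset.mem_univ, if_true]
  rw [Finset.sum_comm]
  unfold shiftSum
  simp only [Finset.mul_sum]

variable {μ : ℕ → ℝ} {z : ℝ}

/-- The first Virasoro constraint, with an insertion of `pₘ` for `m ≤ 2`. -/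
theorem virasoro_one (h : ∀ k ≤ 2 * (N + 4),
      z * μ (k + 2) + ((k : ℝ) + 2 - 3 * (N + 4)) * μ (k + 1) + μ k = 0) {m : ℕ} (hm : m ≤ 2)
    {G : (Fin N ⊕ Fin 4 → ℕ) → ℝ} (hG : G = fun e => hankelMinor μ e (topFour N 0 1 2 3)) (a) :
    let e := topFour N 0 1 2 3 + Pi.single a m
    z * shiftSum 2 G e + (N + 4) * G e + ∑ i, ((e i : ℝ) + (2 - 3 * (N + 4))) * G (e + Pi.single i 1) +
      (N + 3) * shiftSum 1 G e = 0 := by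
  intro e
  have hv := virasoro_hankelMinor (μ := μ) (z := z) (b := 3 * (N + 4)) (e := e)
    (f := topFour N 0 1 2 3) (k := 0) (fun i j => by
      have := h (e i + topFour N 0 1 2 3 j) (by
        have h1 := topFour_le (N := N) i
        have h2 := topFour_le (N := N) j
        have h3 : (Pi.single a m : Fin N ⊕ Fin 4 → ℕ) i ≤ m := by
          rw [Pi.single_apply]; split_ifs <;> omega
        simp only [e, Pi.add_apply]
        omega)
      simpa only [add_zero] using this)
  have hf := (isAlternatingFun_hankelMinor_right μ e).sum_mul_shift_one
    (fun j => (topFour N 0 1 2 3 j : ℝ))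
  rw [topFour_inr_three, ← shiftSum_hankelMinor_comm] at hf
  rw [zero_add, zero_add, hf, shiftSum_zero, ← hG] at hv
  have hs : ∑ i, ((e i : ℝ) + (0 : ℕ) + 2 - 3 * (N + 4)) * hankelMinor μ (e + Pi.single i 1)
      (topFour N 0 1 2 3) = ∑ i, ((e i : ℝ) + (2 - 3 * (N + 4))) * G (e + Pi.single i 1) := by
    refine Finset.sum_congr rfl fun i _ => ?_
    rw [hG]; push_cast; ring
  rw [hs] at hv
  have hc : (Fintype.card (Fin N ⊕ Fin 4) : ℝ) = N + 4 := by simp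
  rw [hc, show hankelMinor μ e (topFour N 0 1 2 3) = G e by rw [hG]] at hv
  exact hv

/-- Summing `virasoro_one` over the position of the insertion. The weights at the largest exponent
add up to `(N + 3) + 2 - 3 (N + 4) + (N + 3) = -(N + 4)`; the last term arises when both shifts hit
the same exponent. -/
theorem virasoro_one_insertion (h : ∀ k ≤ 2 * (N + 4),
      z * μ (k + 2) + ((k : ℝ) + 2 - 3 * (N + 4)) * μ (k + 1) + μ k = 0) {m : ℕ} (hm : m ≤ 2)
    {G : (Fin N ⊕ Fin 4 → ℕ) → ℝ} (hG : G = fun e => hankelMinor μ e (topFour N 0 1 2 3)) :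
    z * shiftSum m (shiftSum 2 G) (topFour N 0 1 2 3) + (N + 4) * shiftSum m G (topFour N 0 1 2 3) -
      (N + 4) * shiftSum 1 (shiftSum m G) (topFour N 0 1 2 3) +
      m * shiftSum (m + 1) G (topFour N 0 1 2 3) = 0 := by
  have halt : IsAlternatingFun G := by rw [hG]; exact isAlternatingFun_hankelMinor μ _
  have hsum := Finset.sum_eq_zero (s := Finset.univ) fun a _ => virasoro_one h hm hG a
  simp only [Finset.sum_add_distrib, ← Finset.mul_sum] at hsum
  rw [sum_shift_weighted, (halt.isAlternatingFun_shiftSum m).sum_mul_shift_one, topFour_inr_three] at hsum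
  have hc := shiftSum_comm m 1 G (topFour N 0 1 2 3)
  unfold shiftSum at hsum hc ⊢
  linear_combination hsum - (N + 3 : ℝ) * hc

theorem virasoro_two_aux (h : ∀ k ≤ 2 * (N + 4),
      z * μ (k + 2) + ((k : ℝ) + 2 - 3 * (N + 4)) * μ (k + 1) + μ k = 0) {m : ℕ} (hm : m ≤ 1)
    {G : (Fin N ⊕ Fin 4 → ℕ) → ℝ} (hG : G = fun e => hankelMinor μ e (topFour N 0 1 2 3)) (a) :
    let e := topFour N 0 1 2 3 + Pi.single a m
    z * shiftSum 3 G e + shiftSum 1 G e + ∑ i, ((e i : ℝ) + (3 - 3 * (N + 4))) * G (e + Pi.single i 2) +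
      ∑ j, (topFour N 0 1 2 3 j : ℝ) * hankelMinor μ e (topFour N 0 1 2 3 + Pi.single j 2) = 0 := by
  intro e
  have hv := virasoro_hankelMinor (μ := μ) (z := z) (b := 3 * (N + 4)) (e := e)
    (f := topFour N 0 1 2 3) (k := 1) (fun i j => by
      have := h (e i + topFour N 0 1 2 3 j + 1) (by
        have h1 := topFour_le (N := N) i
        have h2 := topFour_le (N := N) j
        have h3 : (Pi.single a m : Fin N ⊕ Fin 4 → ℕ) i ≤ m := by
          rw [Pi.single_apply]; split_ifs <;> omega
        simp only [e, Pi.add_apply]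
        omega)
      exact this)
  rw [← hG] at hv
  have hs : ∑ i, ((e i : ℝ) + (1 : ℕ) + 2 - 3 * (N + 4)) * hankelMinor μ (e + Pi.single i (1 + 1))
      (topFour N 0 1 2 3) = ∑ i, ((e i : ℝ) + (3 - 3 * (N + 4))) * G (e + Pi.single i 2) := by
    refine Finset.sum_congr rfl fun i _ => ?_
    rw [hG]; push_cast; ring
  rw [hs] at hv
  exact hv

/-- The second Virasoro constraint. -/
theorem virasoro_two (h : ∀ k ≤ 2 * (N + 4),
      z * μ (k + 2) + ((k : ℝ) + 2 - 3 * (N + 4)) * μ (k + 1) + μ k = 0)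
    {G : (Fin N ⊕ Fin 4 → ℕ) → ℝ} (hG : G = fun e => hankelMinor μ e (topFour N 0 1 2 3)) :
    z * shiftSum 3 G (topFour N 0 1 2 3) - (N + 4) * shiftSum 2 G (topFour N 0 1 2 3) +
      shiftSum 1 G (topFour N 0 1 2 3) + shiftSum 1 (shiftSum 1 G) (topFour N 0 1 2 3) = 0 := by
  have halt : IsAlternatingFun G := by rw [hG]; exact isAlternatingFun_hankelMinor μ _
  have hv := virasoro_two_aux h (m := 0) (by omega) hG (Sum.inr 0)
  simp only [Pi.single_zero, add_zero] at hv
  have hsym : ∀ j, hankelMinor μ (topFour N 0 1 2 3) (topFour N 0 1 2 3 + Pi.single j 2) =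
      G (topFour N 0 1 2 3 + Pi.single j 2) := fun j => by rw [hG, hankelMinor_comm]
  simp only [hsym] at hv
  rw [halt.sum_mul_shift_two, halt.sum_mul_shift_two, topFour_inr_three, topFour_inr_two] at hv
  obtain ⟨h1, h2, -, -⟩ := halt.schur_power_sum
  -- Row and column weights collect to `-(N + 3) s₂ + (N + 5) s₁₁ = p₁² - (N + 4) p₂`.
  linear_combination hv - (N + 3 : ℝ) / 2 * h1 + (N + 5 : ℝ) / 2 * h2

/-- The second Virasoro constraint, with an insertion of `p₁`. -/
theorem virasoro_two_insertion (h : ∀ k ≤ 2 * (N + 4),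
      z * μ (k + 2) + ((k : ℝ) + 2 - 3 * (N + 4)) * μ (k + 1) + μ k = 0)
    {G : (Fin N ⊕ Fin 4 → ℕ) → ℝ} (hG : G = fun e => hankelMinor μ e (topFour N 0 1 2 3)) :
    z * shiftSum 3 (shiftSum 1 G) (topFour N 0 1 2 3) + shiftSum 3 G (topFour N 0 1 2 3) -
      (N + 4) * shiftSum 2 (shiftSum 1 G) (topFour N 0 1 2 3) +
      shiftSum 1 (shiftSum 1 G) (topFour N 0 1 2 3) +
      shiftSum 1 (shiftSum 1 (shiftSum 1 G)) (topFour N 0 1 2 3) = 0 := by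
  have halt : IsAlternatingFun G := by rw [hG]; exact isAlternatingFun_hankelMinor μ _
  have halt1 := halt.isAlternatingFun_shiftSum 1
  have hsum := Finset.sum_eq_zero (s := Finset.univ) fun a _ =>
    virasoro_two_aux h (m := 1) le_rfl hG a
  simp only [Finset.sum_add_distrib, ← Finset.mul_sum] at hsum
  -- For fixed shifted columns, the insertion of `p₁` in the rows is read as `shiftSum 1 G` by
  -- symmetry of the minors.
  have hlast : ∑ a, ∑ j, (topFour N 0 1 2 3 j : ℝ) * hankelMinor μ
      (topFour N 0 1 2 3 + Pi.single a 1) (topFour N 0 1 2 3 + Pi.single j 2) =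
      ∑ j, (topFour N 0 1 2 3 j : ℝ) * shiftSum 1 G (topFour N 0 1 2 3 + Pi.single j 2) := by
    rw [Finset.sum_comm]
    refine Finset.sum_congr rfl fun j _ => ?_
    rw [← Finset.mul_sum]
    congr 1
    have := shiftSum_hankelMinor_comm μ (topFour N 0 1 2 3) (topFour N 0 1 2 3 + Pi.single j 2) 1
    rw [hG]
    simp only [hankelMinor_comm μ (topFour N 0 1 2 3)] at this
    exact this
  rw [hlast, sum_shift_weighted, halt1.sum_mul_shift_two, halt1.sum_mul_shift_two, topFour_inr_three,
    topFour_inr_two] at hsum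
  obtain ⟨h1, h2, -, -⟩ := halt1.schur_power_sum
  have hc := shiftSum_comm 1 3 G (topFour N 0 1 2 3)
  have e3 : ∑ a, shiftSum 3 G (topFour N 0 1 2 3 + Pi.single a 1) =
    shiftSum 1 (shiftSum 3 G) (topFour N 0 1 2 3) := rfl
  have e1 : ∑ a, shiftSum 1 G (topFour N 0 1 2 3 + Pi.single a 1) =
    shiftSum 1 (shiftSum 1 G) (topFour N 0 1 2 3) := rfl
  rw [e3, e1] at hsum
  push_cast at hsum
  linear_combination hsum - (N + 3 : ℝ) / 2 * h1 + (N + 5 : ℝ) / 2 * h2 - z * hc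

/-- The bilinear form of the differential equation for a Hankel determinant whose moments satisfy
a three-term relation. -/
theorem hankel_bilinear (h : ∀ k ≤ 2 * (N + 4),
      z * μ (k + 2) + ((k : ℝ) + 2 - 3 * (N + 4)) * μ (k + 1) + μ k = 0)
    {G : (Fin N ⊕ Fin 4 → ℕ) → ℝ} (hG : G = fun e => hankelMinor μ e (topFour N 0 1 2 3))
    {t₀ t₁ t₂ t₃ t₄ : ℝ} (h₀ : t₀ = G (topFour N 0 1 2 3))
    (h₁ : t₁ = shiftSum 1 G (topFour N 0 1 2 3))
    (h₂ : t₂ = shiftSum 1 (shiftSum 1 G) (topFour N 0 1 2 3))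
    (h₃ : t₃ = shiftSum 1 (shiftSum 1 (shiftSum 1 G)) (topFour N 0 1 2 3))
    (h₄ : t₄ = shiftSum 1 (shiftSum 1 (shiftSum 1 (shiftSum 1 G))) (topFour N 0 1 2 3)) :
    z ^ 3 * (t₀ * t₄ - 4 * t₁ * t₃ + 3 * t₂ ^ 2) + 4 * z ^ 2 * (t₀ * t₃ - t₁ * t₂) +
      4 * z ^ 2 * (t₀ * t₂ - t₁ ^ 2) + 2 * z * t₀ * t₂ + 2 * z * t₀ * t₁ -
      (N + 4) ^ 2 * z * (t₀ * t₂ - t₁ ^ 2) - (N + 4) ^ 2 * t₀ * t₁ + (N + 4) ^ 2 * t₀ ^ 2 = 0 := by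
  have halt : IsAlternatingFun G := by rw [hG]; exact isAlternatingFun_hankelMinor μ _
  obtain ⟨s2, s11, s21, s22⟩ := halt.schur_power_sum
  have hp := hankelMinor_plucker μ (topFour N 0 1 2 3)
  have hcm : ∀ f, hankelMinor μ (topFour N 0 1 2 3) f = G f := fun f => by
    rw [hG, hankelMinor_comm]
  simp only [hcm] at hp
  rw [← halt.shiftSum_one_0123] at hp
  have v1 := virasoro_one h (m := 0) (by omega) hG (Sum.inr 0)
  simp only [Pi.single_zero, add_zero] at v1
  rw [halt.sum_mul_shift_one, topFour_inr_three] at v1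
  have v11 := virasoro_one_insertion h (m := 1) (by omega) hG
  have v12 := virasoro_one_insertion h (m := 2) (by omega) hG
  have v2 := virasoro_two h hG
  have v21 := virasoro_two_insertion h hG
  rw [shiftSum_comm 1 2] at v11
  rw [shiftSum_comm 1 2] at v12
  norm_num at v11 v12
  rw [← h₀, ← h₁] at hp v1
  rw [← h₂] at s2 s11
  rw [← h₃] at s21
  rw [← h₄] at s22
  rw [← h₁, ← h₂] at v11 v2
  rw [← h₂, ← h₃] at v21
  set A := shiftSum 2 G (topFour N 0 1 2 3)
  -- Twelve times the Plücker relation, in power sums.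
  have hkp : t₀ * (t₄ + 3 * shiftSum 2 (shiftSum 2 G) (topFour N 0 1 2 3) -
      4 * shiftSum 3 (shiftSum 1 G) (topFour N 0 1 2 3)) -
      4 * t₁ * (t₃ - shiftSum 3 G (topFour N 0 1 2 3)) + 3 * (t₂ + A) * (t₂ - A) = 0 := by
    linear_combination 12 * hp + t₀ * s22 - 4 * t₁ * s21 + 3 * (t₂ - A) * s2 +
      6 * G (topFour N 0 1 2 5) * s11
  -- The multiplier `z ^ 3` allows each `p₂²`, `p₃ p₁`, `p₃` and `p₂` to be traded for powers of
  -- `p₁`. The square `A ^ 2` goes by factoring a difference of squares, since `v1` says `z A = (N +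
  -- 4) (t₁ - t₀)`.
  linear_combination z ^ 3 * hkp - 3 * z ^ 2 * t₀ * v12 + 4 * z ^ 2 * t₀ * v21 - 4 * z ^ 2 * t₁ * v2 +
    (3 * z * (z * A + (N + 4) * (t₁ - t₀)) + 3 * (N + 4) * z * t₀ - 4 * (N + 4) * z * t₁ +
      (N + 4) * t₀) * v1 + (N + 4) * z * t₀ * v11 + 2 * z * t₀ * v2

end Bilinear

/-! ### One-dimensional moments -/

section Moments

open Set

/-- The integrand of the `k`-th moment of `τ / n` for the one-particle weight, tilted by
`exp (z τ / n)`. -/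
noncomputable def momentDensity (n k : ℕ) (z τ : ℝ) : ℝ :=
  (τ / n) ^ k * ((τ ^ (3 * n))⁻¹ * Real.exp (-((n : ℝ) / τ))) * Real.exp (z * (τ / n))

/-- The tilted moments of the one-particle weight. -/
noncomputable def delayMoment (n k : ℕ) (z : ℝ) : ℝ :=
  ∫ τ in Ioi (0 : ℝ), momentDensity n k z τ

variable {n k : ℕ} {z τ : ℝ}

theorem momentDensity_nonneg (hτ : 0 ≤ τ) : 0 ≤ momentDensity n k z τ := by
  unfold momentDensity; positivity

theorem inv_pow_mul_exp_le {y : ℝ} (hn : 1 ≤ n) (hy : 0 < y) (m : ℕ) :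
    (y ^ m)⁻¹ * Real.exp (-((n : ℝ) / y)) ≤ m.factorial := by
  have hn' : (1 : ℝ) ≤ n := by exact_mod_cast hn
  have h1 := Real.pow_div_factorial_le_exp (y⁻¹) (by positivity) m
  have h2 : Real.exp y⁻¹ ≤ Real.exp ((n : ℝ) / y) := by
    apply Real.exp_le_exp.2
    rw [inv_eq_one_div]; gcongr
  have h3 := h1.trans h2
  rw [div_le_iff₀ (by positivity)] at h3
  rw [Real.exp_neg, ← div_eq_mul_inv, div_le_iff₀ (Real.exp_pos _), ← inv_pow]
  linarith

/-- Near `0` the factor `exp (-n / τ)` beats the negative power; for `τ ≥ 1` the hypothesis on `k`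
leaves decay of order `τ ^ (-2)`. -/
theorem momentDensity_le (hn : 1 ≤ n) (hz : z ≤ 0) (hk : k + 2 ≤ 3 * n) (hτ : 0 < τ) :
    momentDensity n k z τ ≤ 2 * (3 * n).factorial * (1 + τ ^ 2)⁻¹ := by
  have hn' : (1 : ℝ) ≤ n := by exact_mod_cast hn
  have he : Real.exp (z * (τ / n)) ≤ 1 :=
    Real.exp_le_one_iff.2 (mul_nonpos_of_nonpos_of_nonneg hz (by positivity))
  have hdiv : τ / n ≤ τ := div_le_self hτ.le hn'
  have hfac : (1 : ℝ) ≤ (3 * n).factorial := by exact_mod_cast Nat.factorial_pos _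
  have h1 : momentDensity n k z τ ≤ τ ^ k * ((τ ^ (3 * n))⁻¹ * Real.exp (-((n : ℝ) / τ))) := by
    unfold momentDensity
    calc _ ≤ τ ^ k * ((τ ^ (3 * n))⁻¹ * Real.exp (-((n : ℝ) / τ))) * 1 := by gcongr
      _ = _ := mul_one _
  refine h1.trans ?_
  rw [← div_eq_mul_inv, le_div_iff₀ (by positivity)]
  rcases le_total τ 1 with h | h
  · have h2 := inv_pow_mul_exp_le hn hτ (3 * n)
    have h3 : τ ^ k ≤ 1 := pow_le_one₀ hτ.le h
    have h4 : τ ^ 2 ≤ 1 := pow_le_one₀ hτ.le h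
    calc _ ≤ 1 * ((3 * n).factorial : ℝ) * (1 + 1) := by gcongr
      _ = _ := by ring
  · have h2 : Real.exp (-((n : ℝ) / τ)) ≤ 1 := by
      apply Real.exp_le_one_iff.2
      have : 0 ≤ (n : ℝ) / τ := by positivity
      linarith
    have h3 : τ ^ k * τ ^ 2 ≤ τ ^ (3 * n) := by
      rw [← pow_add]; exact pow_le_pow_right₀ h hk
    have h4 : (1 : ℝ) ≤ τ ^ 2 := one_le_pow₀ h
    calc _ ≤ τ ^ k * ((τ ^ (3 * n))⁻¹ * 1) * (τ ^ 2 + τ ^ 2) := by gcongr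
      _ = 2 * ((τ ^ k * τ ^ 2) * (τ ^ (3 * n))⁻¹) := by ring
      _ ≤ 2 * (τ ^ (3 * n) * (τ ^ (3 * n))⁻¹) := by gcongr
      _ = 2 * 1 := by rw [mul_inv_cancel₀ (by positivity)]
      _ ≤ _ := by gcongr

theorem measurable_momentDensity : Measurable (momentDensity n k z) := by
  unfold momentDensity
  fun_prop

theorem integrableOn_momentDensity (hn : 1 ≤ n) (hz : z ≤ 0) (hk : k + 2 ≤ 3 * n) :
    IntegrableOn (momentDensity n k z) (Ioi 0) := by
  refine Integrable.mono' ((integrable_inv_one_add_sq.const_mul (2 * (3 * n).factorial : ℝ)).integrableOn)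
    measurable_momentDensity.aestronglyMeasurable ?_
  refine (ae_restrict_iff' measurableSet_Ioi).2 (Eventually.of_forall fun τ hτ => ?_)
  rw [Real.norm_of_nonneg (momentDensity_nonneg (le_of_lt hτ))]
  exact momentDensity_le hn hz hk hτ

theorem abs_exp_sub_exp_le {w z x : ℝ} (hw : w ≤ 0) (hz : z ≤ 0) (hx : 0 ≤ x) :
    |Real.exp (w * x) - Real.exp (z * x)| ≤ x * |w - z| := by
  have h := (convex_Iic (0 : ℝ)).norm_image_sub_le_of_norm_hasDerivWithin_le
    (f := fun w => Real.exp (w * x)) (f' := fun w => Real.exp (w * x) * x) (C := x) (x := z) (y := w)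
    (fun y _ => by
      have : HasDerivAt (fun w : ℝ => w * x) x y := by simpa using (hasDerivAt_id y).mul_const x
      exact this.exp.hasDerivWithinAt)
    (fun y hy => by
      have he : Real.exp (y * x) ≤ 1 :=
        Real.exp_le_one_iff.2 (mul_nonpos_of_nonpos_of_nonneg hy hx)
      rw [Real.norm_of_nonneg (by positivity)]
      exact mul_le_of_le_one_left hx he) hz hw
  simpa using h

/-- Difference quotients in `z` are dominated by the density of the next moment at `z = 0`, whose
integrability needs `k + 3 ≤ 3 n`. -/
theorem hasDerivWithinAt_delayMoment (hn : 1 ≤ n) (hz : z ≤ 0) (hk : k + 3 ≤ 3 * n) :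
    HasDerivWithinAt (delayMoment n k) (delayMoment n (k + 1) z) (Iic 0) z := by
  rw [hasDerivWithinAt_iff_tendsto_slope]
  have hslope : ∀ w ∈ Iic (0 : ℝ) \ {z}, slope (delayMoment n k) z w =
      ∫ τ in Ioi (0 : ℝ), (w - z)⁻¹ * (momentDensity n k w τ - momentDensity n k z τ) := by
    intro w hw
    rw [slope_def_module, delayMoment, delayMoment, smul_eq_mul, integral_const_mul, integral_sub]
    · exact integrableOn_momentDensity hn hw.1 (by omega)
    · exact integrableOn_momentDensity hn hz (by omega)
  have hev : (fun w => ∫ τ in Ioi (0 : ℝ),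
      (w - z)⁻¹ * (momentDensity n k w τ - momentDensity n k z τ)) =ᶠ[𝓝[Iic 0 \ {z}] z]
      slope (delayMoment n k) z :=
    eventually_nhdsWithin_of_forall fun w hw => (hslope w hw).symm
  refine Tendsto.congr' hev ?_
  refine tendsto_integral_filter_of_dominated_convergence (momentDensity n (k + 1) 0) ?_ ?_
    (integrableOn_momentDensity hn le_rfl (by omega)) ?_
  · exact Eventually.of_forall fun w =>
      ((measurable_momentDensity.sub measurable_momentDensity).const_mul _).aestronglyMeasurable
  · refine eventually_nhdsWithin_of_forall fun w hw => ?_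
    refine (ae_restrict_iff' measurableSet_Ioi).2 (Eventually.of_forall fun τ hτ => ?_)
    have hτ' : (0 : ℝ) < τ := hτ
    have hwz : 0 < |w - z| := abs_pos.2 (sub_ne_zero.2 hw.2)
    have hx := abs_exp_sub_exp_le hw.1 hz (x := τ / n) (by positivity)
    have : momentDensity n k w τ - momentDensity n k z τ =
        (τ / n) ^ k * ((τ ^ (3 * n))⁻¹ * Real.exp (-((n : ℝ) / τ))) *
          (Real.exp (w * (τ / n)) - Real.exp (z * (τ / n))) := by
      unfold momentDensity; ring
    rw [this, norm_mul, norm_mul, norm_inv, Real.norm_eq_abs, Real.norm_eq_abs, Real.norm_eq_abs,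
      abs_of_nonneg (by positivity : 0 ≤ (τ / n) ^ k * ((τ ^ (3 * n))⁻¹ * Real.exp (-((n : ℝ) / τ)))),
      inv_mul_le_iff₀ hwz]
    calc _ ≤ (τ / n) ^ k * ((τ ^ (3 * n))⁻¹ * Real.exp (-((n : ℝ) / τ))) * (τ / n * |w - z|) := by
          gcongr
      _ = _ := by unfold momentDensity; rw [zero_mul, Real.exp_zero]; ring
  · refine (ae_restrict_iff' measurableSet_Ioi).2 (Eventually.of_forall fun τ hτ => ?_)
    have hd : HasDerivAt (fun w => momentDensity n k w τ) (momentDensity n (k + 1) z τ) z := by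
      have h1 : HasDerivAt (fun w : ℝ => w * (τ / n)) (τ / n) z := by
        simpa using (hasDerivAt_id z).mul_const (τ / n)
      have h2 := h1.exp.const_mul ((τ / n) ^ k * ((τ ^ (3 * n))⁻¹ * Real.exp (-((n : ℝ) / τ))))
      exact h2.congr_deriv (by unfold momentDensity; ring)
    have := hasDerivWithinAt_iff_tendsto_slope.1 (hd.hasDerivWithinAt (s := Iic 0))
    refine this.congr fun w => ?_
    rw [slope_def_module, smul_eq_mul]

/-- In `x = τ / n` the function is a constant times `x ^ (k + 2 - 3 n) exp (-1 / x + z x)`, with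
logarithmic derivative `(k + 2 - 3 n) / x + 1 / x² + z`; the factor `n` compensates for `dx / dτ`.
-/
theorem hasDerivAt_momentDensity (hn : 1 ≤ n) (hτ : 0 < τ) :
    HasDerivAt (fun τ => n * momentDensity n (k + 2) z τ)
      (z * momentDensity n (k + 2) z τ + ((k : ℝ) + 2 - 3 * n) * momentDensity n (k + 1) z τ +
        momentDensity n k z τ) τ := by
  have hn' : (n : ℝ) ≠ 0 := by positivity
  have h1 : HasDerivAt (fun τ : ℝ => τ / n) (1 / n) τ := (hasDerivAt_id τ).div_const _
  have h2 := h1.pow (k + 2)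
  have h3 := (hasDerivAt_pow (3 * n) τ).inv (by positivity)
  have h4 : HasDerivAt (fun τ : ℝ => -((n : ℝ) / τ)) (n / τ ^ 2) τ := by
    have := ((hasDerivAt_inv hτ.ne').const_mul (n : ℝ)).neg
    simp only [div_eq_mul_inv]
    exact this.congr_deriv (by ring)
  have h5 := (h1.const_mul z).exp
  have h6 := ((h2.mul (h3.mul h4.exp)).mul h5).const_mul (n : ℝ)
  have h3n : τ ^ (3 * n - 1) * τ = τ ^ (3 * n) := by
    rw [← pow_succ]; congr 1; omega
  refine HasDerivAt.congr_deriv (f := fun τ => n * momentDensity n (k + 2) z τ) h6 ?_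
  simp only [momentDensity, Pi.mul_apply, Pi.inv_apply, Pi.pow_apply]
  have h7 : ((3 * n : ℕ) : ℝ) * τ ^ (3 * n - 1) = 3 * n * τ ^ (3 * n) / τ := by
    rw [← h3n]; push_cast; field_simp
  rw [h7]
  have hp : τ ^ (3 * n) ≠ 0 := by positivity
  generalize Real.exp (-((n : ℝ) / τ)) = E₁
  generalize Real.exp (z * (τ / n)) = E₂
  generalize τ ^ (3 * n) = P at hp ⊢
  obtain ⟨y, rfl⟩ : ∃ y, τ = n * y := ⟨τ / n, by field_simp⟩
  have hy : y ≠ 0 := by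
    rintro rfl
    simp at hτ
  rw [mul_div_cancel_left₀ _ hn']
  simp only [show k + 2 - 1 = k + 1 by omega]
  push_cast
  field_simp
  ring

/-- The integral over `(0, ∞)` of a total derivative whose primitive vanishes at both ends. -/
theorem delayMoment_recurrence (hn : 1 ≤ n) (hz : z ≤ 0) (hk : k + 4 ≤ 3 * n) :
    z * delayMoment n (k + 2) z + ((k : ℝ) + 2 - 3 * n) * delayMoment n (k + 1) z +
      delayMoment n k z = 0 := by
  have hn' : (1 : ℝ) ≤ n := by exact_mod_cast hn
  have i2 := integrableOn_momentDensity (k := k + 2) hn hz (by omega)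
  have i1 := integrableOn_momentDensity (k := k + 1) hn hz (by omega)
  have i0 := integrableOn_momentDensity (k := k) hn hz (by omega)
  have hint : IntegrableOn (fun τ => z * momentDensity n (k + 2) z τ +
      ((k : ℝ) + 2 - 3 * n) * momentDensity n (k + 1) z τ + momentDensity n k z τ) (Ioi 0) :=
    ((i2.const_mul z).add (i1.const_mul _)).add i0
  set B : ℝ := 2 * (3 * n).factorial with hB
  have hB0 : 0 ≤ B := by positivity
  have hzero : (n : ℝ) * momentDensity n (k + 2) z 0 = 0 := by simp [momentDensity]
  have hinv : ∀ τ : ℝ, (1 + τ ^ 2)⁻¹ ≤ 1 := fun τ => inv_le_one_of_one_le₀ (by nlinarith [sq_nonneg τ])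
  have hcont : ContinuousWithinAt (fun τ => n * momentDensity n (k + 2) z τ) (Ici 0) 0 := by
    unfold ContinuousWithinAt
    simp only [hzero]
    refine squeeze_zero' (g := fun τ => n * (B * τ ^ 2))
      (eventually_nhdsWithin_of_forall fun τ hτ => ?_)
      (eventually_nhdsWithin_of_forall fun τ hτ => ?_) ?_
    · exact mul_nonneg (by positivity) (momentDensity_nonneg hτ)
    · rcases (mem_Ici.1 hτ).eq_or_lt with h | h
      · rw [← h, hzero]; simp
      · have h1 : momentDensity n (k + 2) z τ = (τ / n) ^ 2 * momentDensity n k z τ := by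
          unfold momentDensity; ring
        have h2 : τ / n ≤ τ := div_le_self h.le hn'
        have h3 := momentDensity_le (k := k) hn hz (by omega) h
        have h4 : momentDensity n k z τ ≤ B :=
          h3.trans (mul_le_of_le_one_right hB0 (hinv τ))
        have h5 := momentDensity_nonneg (n := n) (k := k) (z := z) h.le
        rw [h1]
        calc (n : ℝ) * ((τ / n) ^ 2 * momentDensity n k z τ) ≤ n * (τ ^ 2 * B) := by gcongr
          _ = _ := by ring
    · have : Tendsto (fun τ : ℝ => (n : ℝ) * (B * τ ^ 2)) (𝓝 0) (𝓝 (n * (B * 0 ^ 2))) :=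
        (by fun_prop : Continuous fun τ : ℝ => (n : ℝ) * (B * τ ^ 2)).tendsto 0
      simp only [ne_eq, OfNat.ofNat_ne_zero, not_false_eq_true, zero_pow, mul_zero] at this
      exact this.mono_left nhdsWithin_le_nhds
  have htop : Tendsto (fun τ => n * momentDensity n (k + 2) z τ) atTop (𝓝 0) := by
    refine squeeze_zero' (g := fun τ => n * (B * (1 + τ ^ 2)⁻¹)) ?_ ?_ ?_
    · filter_upwards [eventually_ge_atTop 0] with τ hτ
      exact mul_nonneg (by positivity) (momentDensity_nonneg hτ)
    · filter_upwards [eventually_gt_atTop 0] with τ hτ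
      have := momentDensity_le (k := k + 2) hn hz (by omega) hτ
      gcongr
    · have h1 : Tendsto (fun τ : ℝ => 1 + τ ^ 2) atTop atTop :=
        tendsto_atTop_add_const_left _ _ (tendsto_pow_atTop two_ne_zero)
      have := (h1.inv_tendsto_atTop.const_mul B).const_mul (n : ℝ)
      simpa using this
  have h := integral_Ioi_of_hasDerivAt_of_tendsto hcont
    (fun τ hτ => hasDerivAt_momentDensity (k := k) (z := z) hn hτ) hint htop
  have i21 : IntegrableOn (fun τ => z * momentDensity n (k + 2) z τ +
      ((k : ℝ) + 2 - 3 * n) * momentDensity n (k + 1) z τ) (Ioi 0) :=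
    (i2.const_mul z).add (i1.const_mul _)
  rw [hzero, sub_zero, integral_add i21 i0, integral_add (i2.const_mul z) (i1.const_mul _), integral_const_mul, integral_const_mul] at h
  exact h

end Moments

/-! ### Andréief's identity and the generating function -/

/-- **Andréief's identity.** -/
theorem andreief {ι α : Type*} [Fintype ι] [DecidableEq ι] [MeasurableSpace α] (ν : Measure α)
    [SigmaFinite ν] (φ ψ : ι → α → ℝ) (h : ∀ i j, Integrable (fun x => φ i x * ψ j x) ν) :
    Integrable (fun x : ι → α => (Matrix.of fun j i => φ j (x i)).det *
      (Matrix.of fun j i => ψ j (x i)).det) (Measure.pi fun _ => ν) ∧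
    ∫ x : ι → α, (Matrix.of fun j i => φ j (x i)).det * (Matrix.of fun j i => ψ j (x i)).det
      ∂(Measure.pi fun _ => ν) =
      (Fintype.card ι).factorial * (Matrix.of fun i j => ∫ x, φ i x * ψ j x ∂ν).det := by
  have hexp : ∀ x : ι → α, (Matrix.of fun j i => φ j (x i)).det *
      (Matrix.of fun j i => ψ j (x i)).det = ∑ σ : Equiv.Perm ι, ∑ ρ : Equiv.Perm ι,
        ((Equiv.Perm.sign σ : ℤ) : ℝ) * ((Equiv.Perm.sign ρ : ℤ) : ℝ) *
          ∏ i, (φ (σ i) (x i) * ψ (ρ i) (x i)) := by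
    intro x
    rw [Matrix.det_apply', Matrix.det_apply', Finset.sum_mul_sum]
    refine Finset.sum_congr rfl fun σ _ => Finset.sum_congr rfl fun ρ _ => ?_
    simp only [Matrix.of_apply, Finset.prod_mul_distrib]
    ring
  simp only [hexp]
  have hi : ∀ σ ρ : Equiv.Perm ι, Integrable (fun x : ι → α =>
      ((Equiv.Perm.sign σ : ℤ) : ℝ) * ((Equiv.Perm.sign ρ : ℤ) : ℝ) *
          ∏ i, (φ (σ i) (x i) * ψ (ρ i) (x i))) (Measure.pi fun _ => ν) := fun σ ρ =>
    (Integrable.fintype_prod (f := fun i x => φ (σ i) x * ψ (ρ i) x)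
      fun i => h (σ i) (ρ i)).const_mul _
  refine ⟨integrable_finsetSum _ fun σ _ => integrable_finsetSum _ fun ρ _ => hi σ ρ, ?_⟩
  rw [integral_finsetSum _ fun σ _ => integrable_finsetSum _ fun ρ _ => hi σ ρ]
  set M : Matrix ι ι ℝ := Matrix.of fun i j => ∫ x, φ i x * ψ j x ∂ν with hM
  -- For each fixed `σ` the sum over `ρ` is `sign σ` times a row-permuted determinant, so all `n!`
  -- terms are equal.
  have hσ : ∀ σ : Equiv.Perm ι, ∫ x : ι → α, ∑ ρ : Equiv.Perm ι,
      ((Equiv.Perm.sign σ : ℤ) : ℝ) * ((Equiv.Perm.sign ρ : ℤ) : ℝ) *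
          ∏ i, (φ (σ i) (x i) * ψ (ρ i) (x i)) ∂(Measure.pi fun _ => ν) = M.det := by
    intro σ
    rw [integral_finsetSum _ fun ρ _ => hi σ ρ]
    have hρ : ∀ ρ : Equiv.Perm ι, ∫ x : ι → α,
        ((Equiv.Perm.sign σ : ℤ) : ℝ) * ((Equiv.Perm.sign ρ : ℤ) : ℝ) *
          ∏ i, (φ (σ i) (x i) * ψ (ρ i) (x i)) ∂(Measure.pi fun _ => ν) =
        ((Equiv.Perm.sign σ : ℤ) : ℝ) * (((Equiv.Perm.sign ρ : ℤ) : ℝ) *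
          ∏ i, (M.submatrix σ id).transpose (ρ i) i) := by
      intro ρ
      rw [integral_const_mul,
        integral_fintype_prod_eq_prod (f := fun i x => φ (σ i) x * ψ (ρ i) x), mul_assoc]
      rfl
    simp only [hρ]
    rw [← Finset.mul_sum, ← Matrix.det_apply', Matrix.det_transpose, Matrix.det_permute, ← mul_assoc,
      ← Int.cast_mul, Int.units_coe_mul_self, Int.cast_one, one_mul]
  simp only [hσ]
  rw [Finset.sum_const, nsmul_eq_mul, Finset.card_univ, Fintype.card_perm]

section Partition

open Set

/-- The Hankel determinant of the tilted moments. -/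
noncomputable def delayHankel (n : ℕ) (z : ℝ) : ℝ :=
  (Matrix.of fun i j : Fin n => delayMoment n (i + j) z).det

/-- The constant relating the partition function to the Hankel determinant. -/
noncomputable def delayConst (n : ℕ) : ℝ :=
  (∏ j : Fin n, ∏ _k ∈ Finset.Ioi j, (n : ℝ) ^ 2) * n.factorial

variable {n : ℕ} {z : ℝ}

theorem delayConst_pos (hn : 1 ≤ n) : 0 < delayConst n := by
  unfold delayConst; positivity

/-- The squared Vandermonde product is rescaled to `τ / n`, at the cost of `n ^ 2` per pair, and one
of its two factors absorbs weight and tilt column by column. -/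
theorem delayWeight_mul_exp (hn : 1 ≤ n) (τ : Fin n → ℝ) :
    delayWeight n τ * Real.exp (z * wignerDelayTime n τ) =
      (∏ j : Fin n, ∏ _k ∈ Finset.Ioi j, (n : ℝ) ^ 2) *
      ((Matrix.of fun j i : Fin n => (τ i / n) ^ (j : ℕ)).det *
      (Matrix.of fun j i : Fin n => momentDensity n j z (τ i)).det) := by
  have hn' : (n : ℝ) ≠ 0 := by positivity
  set V : Matrix (Fin n) (Fin n) ℝ := Matrix.vandermonde fun i => τ i / n with hV
  have h1 : (Matrix.of fun j i : Fin n => (τ i / n) ^ (j : ℕ)).det = V.det := by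
    rw [← Matrix.det_transpose]; rfl
  have h2 : (Matrix.of fun j i : Fin n => momentDensity n j z (τ i)).det =
      (∏ i, ((τ i ^ (3 * n))⁻¹ * Real.exp (-((n : ℝ) / τ i)) * Real.exp (z * (τ i / n)))) * V.det := by
    rw [← h1, ← Matrix.det_mul_row]
    congr 1
    ext j i
    simp only [Matrix.of_apply, momentDensity]
    ring
  have h3 : ∏ j : Fin n, ∏ k ∈ Finset.Ioi j, |τ k - τ j| ^ 2 =
      (∏ j : Fin n, ∏ _k ∈ Finset.Ioi j, (n : ℝ) ^ 2) * (V.det * V.det) := by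
    rw [hV, Matrix.det_vandermonde, ← Finset.prod_mul_distrib, ← Finset.prod_mul_distrib]
    refine Finset.prod_congr rfl fun j _ => ?_
    rw [← Finset.prod_mul_distrib, ← Finset.prod_mul_distrib]
    refine Finset.prod_congr rfl fun k _ => ?_
    rw [sq_abs]
    field_simp
  have h4 : Real.exp (z * wignerDelayTime n τ) = ∏ i, Real.exp (z * (τ i / n)) := by
    rw [← Real.exp_sum, wignerDelayTime, Finset.mul_sum, Finset.mul_sum]
    congr 1
    refine Finset.sum_congr rfl fun i _ => ?_
    ring
  rw [delayWeight, h1, h2, h3, h4, Finset.prod_mul_distrib (g := fun i => Real.exp (z * (τ i / n)))]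
  ring

theorem volume_restrict_orthant :
    (volume.restrict {τ : Fin n → ℝ | ∀ j, 0 < τ j}) =
      Measure.pi fun _ : Fin n => (volume : Measure ℝ).restrict (Ioi 0) := by
  have : {τ : Fin n → ℝ | ∀ j, 0 < τ j} = Set.pi univ fun _ => Ioi 0 := by
    ext τ; simp
  rw [this, volume_pi, Measure.restrict_pi_pi]

theorem integral_delayWeight_mul_exp (hn : 1 ≤ n) (hz : z ≤ 0) :
    Integrable (fun τ => delayWeight n τ * Real.exp (z * wignerDelayTime n τ))
      (volume.restrict {τ : Fin n → ℝ | ∀ j, 0 < τ j}) ∧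
    ∫ τ in {τ : Fin n → ℝ | ∀ j, 0 < τ j}, delayWeight n τ * Real.exp (z * wignerDelayTime n τ) =
      delayConst n * delayHankel n z := by
  have hmul : ∀ i j : Fin n, (fun x : ℝ => (x / n) ^ (i : ℕ) * momentDensity n j z x) =
      momentDensity n (i + j) z := by
    intro i j
    ext x
    unfold momentDensity
    ring
  have ha := andreief ((volume : Measure ℝ).restrict (Ioi 0))
    (fun (j : Fin n) x => (x / n) ^ (j : ℕ)) (fun j x => momentDensity n j z x) (fun i j => by
      rw [hmul]
      exact integrableOn_momentDensity hn hz (by omega))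
  simp only [delayWeight_mul_exp hn]
  rw [volume_restrict_orthant]
  refine ⟨ha.1.const_mul _, ?_⟩
  rw [integral_const_mul, ha.2, Fintype.card_fin, ← mul_assoc]
  unfold delayConst delayHankel
  congr 2
  ext i j
  simp only [Matrix.of_apply, hmul]
  rfl

theorem delayWeight_nonneg {τ : Fin n → ℝ} (hτ : ∀ j, 0 < τ j) : 0 ≤ delayWeight n τ := by
  unfold delayWeight
  refine mul_nonneg (Finset.prod_nonneg fun j _ => ?_) (by positivity)
  have := hτ j
  positivity

theorem measurable_delayWeight : Measurable (delayWeight n) := by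
  unfold delayWeight
  fun_prop

theorem measurableSet_orthant : MeasurableSet {τ : Fin n → ℝ | ∀ j, 0 < τ j} := by
  have : {τ : Fin n → ℝ | ∀ j, 0 < τ j} = Set.pi univ fun _ => Ioi 0 := by
    ext τ; simp
  rw [this]
  exact MeasurableSet.univ_pi fun _ => measurableSet_Ioi

/-- The integrand is nonnegative, and positive on the nonempty open set of positive tuples with
distinct entries. -/
theorem delayHankel_pos (hn : 1 ≤ n) (hz : z ≤ 0) : 0 < delayHankel n z := by
  obtain ⟨hi, he⟩ := integral_delayWeight_mul_exp (n := n) hn hz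
  have hpos : 0 < ∫ τ in {τ : Fin n → ℝ | ∀ j, 0 < τ j},
      delayWeight n τ * Real.exp (z * wignerDelayTime n τ) := by
    rw [integral_pos_iff_support_of_nonneg_ae _ hi]
    · set U : Set (Fin n → ℝ) := {τ | ∀ j, 0 < τ j} ∩
        {τ | 0 < ∏ j : Fin n, ∏ k ∈ Finset.Ioi j, |τ k - τ j| ^ 2} with hU
      have hopen : IsOpen U := by
        refine IsOpen.inter ?_ (isOpen_lt continuous_const (by fun_prop))
        have : {τ : Fin n → ℝ | ∀ j, 0 < τ j} = Set.pi univ fun _ => Ioi 0 := by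
          ext τ; simp
        rw [this]
        exact isOpen_set_pi finite_univ fun _ _ => isOpen_Ioi
      have hne : U.Nonempty := by
        refine ⟨fun j => (j : ℝ) + 1, fun j => by positivity, ?_⟩
        change (0 : ℝ) < ∏ j : Fin n, ∏ k ∈ Finset.Ioi j, |((k : ℕ) : ℝ) + 1 - (((j : ℕ) : ℝ) + 1)| ^ 2
        refine Finset.prod_pos fun j _ => Finset.prod_pos fun k hk => ?_
        have : (j : ℕ) < k := Fin.lt_def.1 (Finset.mem_Ioi.1 hk)
        have : ((j : ℕ) : ℝ) < k := by exact_mod_cast this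
        have : (0 : ℝ) < |(k : ℝ) + 1 - ((j : ℝ) + 1)| := abs_pos.2 (by linarith)
        positivity
      rw [Measure.restrict_apply' measurableSet_orthant]
      refine (hopen.measure_pos volume hne).trans_le (measure_mono fun τ hτ => ⟨?_, hτ.1⟩)
      refine (mul_pos (mul_pos (Finset.prod_pos fun j _ => ?_) hτ.2) (Real.exp_pos _)).ne'
      have := hτ.1 j
      positivity
    · refine (ae_restrict_iff' measurableSet_orthant).2 (Eventually.of_forall fun τ hτ => ?_)
      exact mul_nonneg (delayWeight_nonneg hτ) (Real.exp_pos _).le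
  rw [he] at hpos
  exact (mul_pos_iff_of_pos_left (delayConst_pos hn)).1 hpos

theorem delayMeasure_univ (hn : 1 ≤ n) :
    delayMeasure n univ = ENNReal.ofReal (delayConst n * delayHankel n 0) := by
  obtain ⟨hi, he⟩ := integral_delayWeight_mul_exp (n := n) hn le_rfl
  simp only [zero_mul, Real.exp_zero, mul_one] at hi he
  rw [delayMeasure, withDensity_apply _ MeasurableSet.univ, Measure.restrict_univ, ← he,
    ofReal_integral_eq_lintegral_ofReal hi]
  exact (ae_restrict_iff' measurableSet_orthant).2
    (Eventually.of_forall fun τ hτ => delayWeight_nonneg hτ)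

/-- The generating function is a ratio of Hankel determinants. -/
theorem delayCgf_eq (hn : 1 ≤ n) (hz : z ≤ 0) :
    delayCgf n z = Real.log (delayHankel n z) - Real.log (delayHankel n 0) := by
  have h0 := delayHankel_pos hn (le_refl (0 : ℝ))
  have hC := delayConst_pos hn
  have hzp := delayHankel_pos hn hz
  have hmgf : mgf (wignerDelayTime n) (delayLaw n) z = delayHankel n z / delayHankel n 0 := by
    rw [mgf, delayLaw, integral_smul_measure, delayMeasure_univ hn, delayMeasure,
      integral_withDensity_eq_integral_toReal_smul measurable_delayWeight.ennreal_ofReal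
        (Eventually.of_forall fun _ => ENNReal.ofReal_lt_top)]
    have hcongr : ∫ τ in {τ : Fin n → ℝ | ∀ j, 0 < τ j},
        (ENNReal.ofReal (delayWeight n τ)).toReal • Real.exp (z * wignerDelayTime n τ) =
        ∫ τ in {τ : Fin n → ℝ | ∀ j, 0 < τ j},
          delayWeight n τ * Real.exp (z * wignerDelayTime n τ) :=
      setIntegral_congr_fun measurableSet_orthant fun τ hτ => by
        simp only [smul_eq_mul]
        rw [ENNReal.toReal_ofReal (delayWeight_nonneg hτ)]
    rw [hcongr, (integral_delayWeight_mul_exp hn hz).2, ENNReal.toReal_inv,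
      ENNReal.toReal_ofReal (by positivity), smul_eq_mul]
    field_simp
  rw [delayCgf, cgf, hmgf, Real.log_div hzp.ne' h0.ne']

end Partition

/-! ### One-sided Taylor coefficients -/

section Jets

open Set

/-- `f` is `M` times continuously differentiable on `(-∞, 0]` and its Taylor coefficients at `0` up
to order `M` are those of `P`. -/
def HasJet (M : ℕ) (f : ℝ → ℝ) (P : ℝ⟦X⟧) : Prop :=
  ContDiffOn ℝ M f (Iic 0) ∧
    ∀ k ≤ M, iteratedDerivWithin k f (Iic 0) 0 = k.factorial * coeff k P

variable {M : ℕ} {f g : ℝ → ℝ} {P Q : ℝ⟦X⟧}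

theorem HasJet.mono (h : HasJet M f P) {m : ℕ} (hm : m ≤ M) : HasJet m f P :=
  ⟨h.1.of_le (by exact_mod_cast hm), fun k hk => h.2 k (hk.trans hm)⟩

theorem HasJet.contDiffWithinAt (h : HasJet M f P) {k : ℕ} (hk : k ≤ M) :
    ContDiffWithinAt ℝ k f (Iic 0) 0 :=
  (h.1.of_le (by exact_mod_cast hk)).contDiffWithinAt self_mem_Iic

theorem HasJet.add (hf : HasJet M f P) (hg : HasJet M g Q) :
    HasJet M (fun z => f z + g z) (P + Q) := by
  refine ⟨hf.1.add hg.1, fun k hk => ?_⟩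
  rw [iteratedDerivWithin_fun_add self_mem_Iic (uniqueDiffOn_Iic 0) (hf.contDiffWithinAt hk)
    (hg.contDiffWithinAt hk), hf.2 k hk, hg.2 k hk, map_add]
  ring

theorem HasJet.mul (hf : HasJet M f P) (hg : HasJet M g Q) :
    HasJet M (fun z => f z * g z) (P * Q) := by
  refine ⟨hf.1.mul hg.1, fun k hk => ?_⟩
  have h := iteratedDerivWithin_mul self_mem_Iic (uniqueDiffOn_Iic 0) (hf.contDiffWithinAt hk)
    (hg.contDiffWithinAt hk)
  change iteratedDerivWithin k (f * g) (Iic 0) 0 = _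
  rw [h, coeff_mul, Finset.Nat.sum_antidiagonal_eq_sum_range_succ_mk, Finset.mul_sum]
  refine Finset.sum_congr rfl fun i hi => ?_
  have hik : i ≤ k := Nat.lt_succ_iff.1 (Finset.mem_range.1 hi)
  rw [hf.2 i (hik.trans hk), hg.2 (k - i) ((Nat.sub_le _ _).trans hk)]
  have := Nat.choose_mul_factorial_mul_factorial hik
  rw [← this]
  push_cast
  ring

theorem HasJet.const (M : ℕ) (c : ℝ) : HasJet M (fun _ => c) (C c) := by
  refine ⟨contDiffOn_const, fun k _ => ?_⟩
  rw [iteratedDerivWithin_const, coeff_C]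
  split_ifs with h
  · simp [h]
  · simp

theorem HasJet.deriv (hf : HasJet (M + 1) f P)
    (hg : ∀ z ≤ 0, HasDerivWithinAt f (g z) (Iic 0) z) : HasJet M g (d⁄dX ℝ P) := by
  have hu := uniqueDiffOn_Iic (0 : ℝ)
  have heq : EqOn (derivWithin f (Iic 0)) g (Iic 0) := fun z hz => (hg z hz).derivWithin (hu z hz)
  have hc : ContDiffOn ℝ M (derivWithin f (Iic 0)) (Iic 0) := hf.1.derivWithin hu (by norm_cast)
  refine ⟨hc.congr fun z hz => (heq hz).symm, fun k hk => ?_⟩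
  rw [← iteratedDerivWithin_congr heq self_mem_Iic, ← iteratedDerivWithin_succ',
    hf.2 (k + 1) (by omega), coeff_derivative, Nat.factorial_succ]
  push_cast
  ring

/-- This turns a differential equation on the half-line into an identity of formal coefficients up
to order `M`. -/
theorem HasJet.coeff_eq_zero (hf : HasJet M f P) (h0 : ∀ z ≤ 0, f z = 0) {k : ℕ} (hk : k ≤ M) :
    coeff k P = 0 := by
  have h := hf.2 k hk
  have heq : EqOn f (fun _ => (0 : ℝ)) (Iic 0) := fun z hz => h0 z hz
  rw [iteratedDerivWithin_congr heq self_mem_Iic, iteratedDerivWithin_const] at h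
  have hk0 : (k.factorial : ℝ) ≠ 0 := by positivity
  have h' : (k.factorial : ℝ) * coeff k P = 0 := by rw [← h]; simp
  exact (mul_eq_zero.1 h').resolve_left hk0

theorem HasJet.id (M : ℕ) : HasJet M (fun z => z) X := by
  refine ⟨contDiffOn_id, fun k _ => ?_⟩
  rcases k with _ | k
  · simp [iteratedDerivWithin_zero]
  · have heq : EqOn (derivWithin (fun z : ℝ => z) (Iic 0)) (fun _ => 1) (Iic 0) := fun z hz =>
      derivWithin_id' z _ (uniqueDiffOn_Iic 0 z hz)
    rw [iteratedDerivWithin_succ', iteratedDerivWithin_congr heq self_mem_Iic,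
      iteratedDerivWithin_const, coeff_X]
    by_cases hk : k = 0
    · simp [hk]
    · simp [hk]

end Jets

/-! ### Smoothness up to the endpoint and the Taylor expansion -/

section Smoothness

open Set

variable {n : ℕ}

theorem continuousOn_delayMoment (hn : 1 ≤ n) {k : ℕ} (hk : k + 2 ≤ 3 * n) :
    ContinuousOn (delayMoment n k) (Iic 0) := by
  refine continuousOn_of_dominated (bound := momentDensity n k 0) ?_ ?_
    (integrableOn_momentDensity hn le_rfl hk) ?_
  · exact fun z _ => measurable_momentDensity.aestronglyMeasurable
  · refine fun z hz => (ae_restrict_iff' measurableSet_Ioi).2 (Eventually.of_forall fun τ hτ => ?_)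
    have hτ' : (0 : ℝ) < τ := hτ
    rw [Real.norm_of_nonneg (momentDensity_nonneg hτ'.le)]
    unfold momentDensity
    have h : Real.exp (z * (τ / n)) ≤ Real.exp (0 * (τ / n)) := by
      apply Real.exp_le_exp.2
      have : 0 ≤ τ / n := by positivity
      rw [zero_mul]
      exact mul_nonpos_of_nonpos_of_nonneg hz this
    gcongr
  · refine Eventually.of_forall fun τ => ?_
    unfold momentDensity
    fun_prop

theorem contDiffOn_delayMoment (hn : 1 ≤ n) (m : ℕ) : ∀ {k : ℕ}, k + m + 2 ≤ 3 * n →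
    ContDiffOn ℝ m (delayMoment n k) (Iic 0) := by
  induction m with
  | zero =>
    intro k hk
    exact contDiffOn_zero.2 (continuousOn_delayMoment hn hk)
  | succ m ih =>
    intro k hk
    have hd : ∀ z ∈ Iic (0 : ℝ), HasDerivWithinAt (delayMoment n k) (delayMoment n (k + 1) z) (Iic 0) z :=
      fun z hz => hasDerivWithinAt_delayMoment hn hz (by omega)
    push_cast
    rw [contDiffOn_succ_iff_derivWithin (uniqueDiffOn_Iic 0)]
    refine ⟨fun z hz => (hd z hz).differentiableWithinAt, by simp, ?_⟩
    exact (ih (k := k + 1) (by omega)).congr fun z hz =>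
      (hd z hz).derivWithin (uniqueDiffOn_Iic 0 z hz)

/-- The entries have index at most `2 n - 2`, and `n` derivatives raise it to `3 n - 2`, the last
index covered by the integrability bound. -/
theorem contDiffOn_delayHankel (hn : 1 ≤ n) : ContDiffOn ℝ n (delayHankel n) (Iic 0) := by
  unfold delayHankel
  simp only [Matrix.det_apply', Matrix.of_apply]
  refine ContDiffOn.sum fun σ _ => contDiffOn_const.mul (contDiffOn_prod fun i _ => ?_)
  exact contDiffOn_delayMoment hn n (by omega)

theorem contDiffOn_delayCgf (hn : 1 ≤ n) : ContDiffOn ℝ n (delayCgf n) (Iic 0) := by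
  have h : ContDiffOn ℝ n (fun z => Real.log (delayHankel n z) - Real.log (delayHankel n 0)) (Iic 0) :=
    ((contDiffOn_delayHankel hn).log fun z hz => (delayHankel_pos hn hz).ne').sub contDiffOn_const
  exact h.congr fun z hz => delayCgf_eq hn hz

/-- The asymptotic expansion of the cumulant generating function. -/
theorem delayCgf_sub_isLittleO (hn : 1 ≤ n) :
    (fun z : ℝ => delayCgf n z -
      ∑ l ∈ Finset.Icc 1 n, delayCumulant n l / (l.factorial : ℝ) * z ^ l)
        =o[𝓝[≤] (0 : ℝ)] fun z : ℝ => z ^ n := by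
  have h := taylor_isLittleO (convex_Iic (0 : ℝ)) self_mem_Iic (contDiffOn_delayCgf hn)
  have h0 : delayCgf n 0 = 0 := by rw [delayCgf_eq hn le_rfl, sub_self]
  simp only [taylor_within_apply, sub_zero] at h
  refine h.congr_left fun z => ?_
  rw [Finset.sum_range_succ', iteratedDerivWithin_zero, h0, smul_zero, add_zero,
    Finset.range_eq_Ico, Finset.sum_Ico_add' (fun k => ((k.factorial : ℝ)⁻¹ * z ^ k) •
      iteratedDerivWithin k (delayCgf n) (Iic 0) 0) 0 n 1, zero_add]
  congr 1
  refine Finset.sum_congr (by ext; simp) fun l _ => ?_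
  rw [delayCumulant, smul_eq_mul]
  ring

/-- The Taylor series of the cumulant generating function, up to order `n`. -/
noncomputable def delayJet (n : ℕ) : ℝ⟦X⟧ :=
  mk fun k => delayCumulant n k / (k.factorial : ℝ)

theorem hasJet_delayCgf (hn : 1 ≤ n) : HasJet n (delayCgf n) (delayJet n) := by
  refine ⟨contDiffOn_delayCgf hn, fun k _ => ?_⟩
  rw [delayJet, coeff_mk, delayCumulant]
  field_simp

end Smoothness

/-! ### The differential equation for the cumulant generating function -/

section Ode

open Set

/-- Since `m_k' = m_{k+1}`, the Leibniz rule raises one column exponent at a time; symmetry moves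
this to the rows. -/
theorem hasDerivWithinAt_hankelMinor {ι : Type*} [Fintype ι] [DecidableEq ι] {n : ℕ} (hn : 1 ≤ n)
    {z : ℝ} (hz : z ≤ 0) {e f : ι → ℕ} (h : ∀ i j, e i + f j + 3 ≤ 3 * n) :
    HasDerivWithinAt (fun z => hankelMinor (fun k => delayMoment n k z) e f)
      (shiftSum 1 (fun e => hankelMinor (fun k => delayMoment n k z) e f) e) (Iic 0) z := by
  rw [shiftSum_hankelMinor_comm]
  unfold hankelMinor shiftSum
  simp only [Matrix.det_apply', Matrix.of_apply]
  rw [Finset.sum_comm]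
  refine HasDerivWithinAt.fun_sum fun σ _ => ?_
  rw [← Finset.mul_sum]
  refine HasDerivWithinAt.const_mul _ ?_
  refine (HasDerivWithinAt.fun_finsetProd (u := Finset.univ) fun i _ =>
    hasDerivWithinAt_delayMoment hn hz (h (σ i) i)).congr_deriv ?_
  refine Finset.sum_congr rfl fun a _ => ?_
  rw [← Finset.mul_prod_erase _ _ (Finset.mem_univ a), smul_eq_mul, mul_comm]
  congr 1
  · simp [add_assoc]
  · refine Finset.prod_congr rfl fun i hi => ?_
    simp [Finset.ne_of_mem_erase hi]

theorem hasDerivWithinAt_iterate_shiftSum {ι : Type*} [Fintype ι] [DecidableEq ι] {n : ℕ}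
    (hn : 1 ≤ n) {z : ℝ} (hz : z ≤ 0) {f : ι → ℕ} (j : ℕ) : ∀ {e : ι → ℕ},
    (∀ a b, e a + f b + j + 3 ≤ 3 * n) →
    HasDerivWithinAt
      (fun z => (shiftSum 1)^[j] (fun e => hankelMinor (fun k => delayMoment n k z) e f) e)
      ((shiftSum 1)^[j + 1] (fun e => hankelMinor (fun k => delayMoment n k z) e f) e) (Iic 0) z := by
  induction j with
  | zero =>
    intro e h
    exact hasDerivWithinAt_hankelMinor hn hz h
  | succ j ih =>
    intro e h
    rw [Function.iterate_succ_apply' (shiftSum 1) (j + 1)]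
    have hL : (fun z => (shiftSum 1)^[j + 1]
        (fun e => hankelMinor (fun k => delayMoment n k z) e f) e) = fun z => shiftSum 1
        ((shiftSum 1)^[j] (fun e => hankelMinor (fun k => delayMoment n k z) e f)) e := by
      funext z
      rw [Function.iterate_succ_apply']
    rw [hL]
    change HasDerivWithinAt (fun z => ∑ i, (shiftSum 1)^[j]
      (fun e => hankelMinor (fun k => delayMoment n k z) e f) (e + Pi.single i 1))
      (∑ i, (shiftSum 1)^[j + 1]
        (fun e => hankelMinor (fun k => delayMoment n k z) e f) (e + Pi.single i 1)) (Iic 0) z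
    refine HasDerivWithinAt.fun_sum fun i _ => ih fun a b => ?_
    have h1 := h a b
    have h2 : (Pi.single i 1 : ι → ℕ) a ≤ 1 := by
      rw [Pi.single_apply]; split_ifs <;> omega
    simp only [Pi.add_apply]
    omega

/-- The `j`-th derivative of the Hankel determinant. -/
noncomputable def hankelDeriv (N j : ℕ) (z : ℝ) : ℝ :=
  (shiftSum 1)^[j] (fun e => hankelMinor (fun k => delayMoment (N + 4) k z) e (topFour N 0 1 2 3))
    (topFour N 0 1 2 3)

variable {N : ℕ} {z : ℝ}

theorem hasDerivWithinAt_hankelDeriv (hz : z ≤ 0) {j : ℕ} (hj : j ≤ 3) :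
    HasDerivWithinAt (hankelDeriv N j) (hankelDeriv N (j + 1) z) (Iic 0) z := by
  refine hasDerivWithinAt_iterate_shiftSum (by omega) hz j fun a b => ?_
  have h1 := topFour_le (N := N) a
  have h2 := topFour_le (N := N) b
  omega

theorem hankelDeriv_zero : hankelDeriv N 0 z = delayHankel (N + 4) z := by
  have hstd : ∀ i : Fin N ⊕ Fin 4, topFour N 0 1 2 3 i = (finSumFinEquiv i : ℕ) := by
    rintro (i | i)
    · simp [topFour]
    · fin_cases i <;> simp [topFour]
  rw [delayHankel, ← Matrix.det_submatrix_equiv_self finSumFinEquiv]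
  change (Matrix.of fun i j => delayMoment (N + 4) (topFour N 0 1 2 3 i + topFour N 0 1 2 3 j) z).det = _
  simp only [hstd]
  rfl

theorem hankelDeriv_bilinear (hz : z ≤ 0) :
    let t := fun j => hankelDeriv N j z
    z ^ 3 * (t 0 * t 4 - 4 * t 1 * t 3 + 3 * t 2 ^ 2) + 4 * z ^ 2 * (t 0 * t 3 - t 1 * t 2) +
      4 * z ^ 2 * (t 0 * t 2 - t 1 ^ 2) + 2 * z * t 0 * t 2 + 2 * z * t 0 * t 1 -
      (N + 4) ^ 2 * z * (t 0 * t 2 - t 1 ^ 2) - (N + 4) ^ 2 * t 0 * t 1 + (N + 4) ^ 2 * t 0 ^ 2 = 0 := by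
  intro t
  refine hankel_bilinear (μ := fun k => delayMoment (N + 4) k z) (fun k hk => ?_) rfl rfl rfl rfl rfl rfl
  have := delayMoment_recurrence (n := N + 4) (k := k) (by omega) hz (by omega)
  push_cast at this
  exact this

/-- Ratios of derivatives of the Hankel determinant to the determinant. -/
noncomputable def hankelRatio (N j : ℕ) (z : ℝ) : ℝ := hankelDeriv N j z / hankelDeriv N 0 z

theorem hasDerivWithinAt_hankelRatio (hz : z ≤ 0) {j : ℕ} (hj : j ≤ 3) :
    HasDerivWithinAt (hankelRatio N j)
      (hankelRatio N (j + 1) z - hankelRatio N j z * hankelRatio N 1 z) (Iic 0) z := by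
  have h0 : hankelDeriv N 0 z ≠ 0 := by
    rw [hankelDeriv_zero]; exact (delayHankel_pos (by omega) hz).ne'
  refine ((hasDerivWithinAt_hankelDeriv hz hj).fun_div
    (hasDerivWithinAt_hankelDeriv hz (j := 0) (by omega)) h0).congr_deriv ?_
  unfold hankelRatio
  rw [zero_add]
  field_simp

theorem hasDerivWithinAt_delayCgf (hz : z ≤ 0) :
    HasDerivWithinAt (delayCgf (N + 4)) (hankelRatio N 1 z) (Iic 0) z := by
  have h0 : hankelDeriv N 0 z ≠ 0 := by
    rw [hankelDeriv_zero]; exact (delayHankel_pos (by omega) hz).ne'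
  have h := ((hasDerivWithinAt_hankelDeriv (N := N) hz (j := 0) (by omega)).log h0).sub_const
    (Real.log (delayHankel (N + 4) 0))
  refine h.congr (fun w hw => ?_) ?_
  · rw [delayCgf_eq (by omega) hw, hankelDeriv_zero]
  · rw [delayCgf_eq (by omega) hz, hankelDeriv_zero]

/-- The Taylor series of the cumulant generating function satisfies a third-order differential
equation. -/
theorem coeff_delayJet_ode {l : ℕ} (hl : l ≤ N) :
    let g := d⁄dX ℝ (delayJet (N + 4))
    let g₁ := d⁄dX ℝ g
    let g₂ := d⁄dX ℝ g₁
    let g₃ := d⁄dX ℝ g₂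
    coeff l (X * X * X * g₃ + C 6 * (X * X * X * (g₁ * g₁)) + C 4 * (X * X * g₂) +
      C 8 * (X * X * (g * g₁)) + C 4 * (X * X * g₁) + C 2 * (X * g₁) + C 2 * (X * g) +
      C 2 * (X * (g * g)) + C (-((N : ℝ) + 4) ^ 2) * (X * g₁ + g) + C (((N : ℝ) + 4) ^ 2)) = 0 := by
  intro g g₁ g₂ g₃
  set r := hankelRatio N with hr
  have hd : ∀ {j : ℕ}, j ≤ 3 → ∀ z ≤ 0, HasDerivWithinAt (r j) (r (j + 1) z - r j z * r 1 z) (Iic 0) z :=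
    fun hj z hz => hasDerivWithinAt_hankelRatio hz hj
  -- Each derivative costs one order of the jet: `N + 4` for `ξ` leaves `N` for its fourth
  -- derivative, whence `l ≤ N`.
  have hξ : HasJet (N + 3 + 1) (delayCgf (N + 4)) (delayJet (N + 4)) := hasJet_delayCgf (by omega)
  have j0 : HasJet (N + 2 + 1) (r 1) g := hξ.deriv fun z hz => hasDerivWithinAt_delayCgf hz
  have d0 : ∀ z ≤ 0, HasDerivWithinAt (r 1) (r 2 z - r 1 z * r 1 z) (Iic 0) z := hd (by omega)
  have j1 : HasJet (N + 1 + 1) (fun z => r 2 z - r 1 z * r 1 z) g₁ := j0.deriv d0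
  have d1 : ∀ z ≤ 0, HasDerivWithinAt (fun z => r 2 z - r 1 z * r 1 z)
      (r 3 z - 3 * r 1 z * r 2 z + 2 * r 1 z ^ 3) (Iic 0) z := fun z hz =>
    ((hd (j := 2) (by omega) z hz).fun_sub ((d0 z hz).fun_mul (d0 z hz))).congr_deriv (by ring)
  have j2 : HasJet (N + 1) (fun z => r 3 z - 3 * r 1 z * r 2 z + 2 * r 1 z ^ 3) g₂ := j1.deriv d1
  have d2 : ∀ z ≤ 0, HasDerivWithinAt (fun z => r 3 z - 3 * r 1 z * r 2 z + 2 * r 1 z ^ 3)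
      (r 4 z - 4 * r 1 z * r 3 z - 3 * r 2 z ^ 2 + 12 * r 1 z ^ 2 * r 2 z - 6 * r 1 z ^ 4)
      (Iic 0) z := fun z hz =>
    (((hd (j := 3) (by omega) z hz).fun_sub
      (((d0 z hz).const_mul 3).fun_mul (hd (j := 2) (by omega) z hz))).fun_add
        (((d0 z hz).fun_pow 3).const_mul 2)).congr_deriv (by push_cast; ring)
  have j3 : HasJet N (fun z => r 4 z - 4 * r 1 z * r 3 z - 3 * r 2 z ^ 2 + 12 * r 1 z ^ 2 * r 2 z -
    6 * r 1 z ^ 4) g₃ := j2.deriv d2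
  replace j0 := j0.mono (m := N) (by omega)
  replace j1 := j1.mono (m := N) (by omega)
  replace j2 := j2.mono (m := N) (by omega)
  have x1 := HasJet.id N
  have x2 := x1.mul x1
  have x3 := x2.mul x1
  have c := HasJet.const N
  refine HasJet.coeff_eq_zero ((((((((((x3.mul j3).add ((c 6).mul (x3.mul (j1.mul j1)))).add
    ((c 4).mul (x2.mul j2))).add ((c 8).mul (x2.mul (j0.mul j1)))).add ((c 4).mul (x2.mul j1))).add
    ((c 2).mul (x1.mul j1))).add ((c 2).mul (x1.mul j0))).add ((c 2).mul (x1.mul (j0.mul j0)))).add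
    ((c (-((N : ℝ) + 4) ^ 2)).mul ((x1.mul j1).add j0))).add (c (((N : ℝ) + 4) ^ 2))) (fun z hz => ?_) hl
  have h0 : hankelDeriv N 0 z ≠ 0 := by
    rw [hankelDeriv_zero]; exact (delayHankel_pos (by omega) hz).ne'
  have hb := hankelDeriv_bilinear (N := N) hz
  have ht : ∀ j, hankelDeriv N j z = r j z * hankelDeriv N 0 z := fun j => by
    rw [hr, hankelRatio, div_mul_cancel₀ _ h0]
  simp only [ht 1, ht 2, ht 3, ht 4] at hb
  have h2 : hankelDeriv N 0 z ^ 2 ≠ 0 := pow_ne_zero 2 h0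
  -- Dividing the bilinear equation by the square of the determinant leaves the equation in the
  -- ratios, that is, in the derivatives of `ξ`.
  apply mul_left_cancel₀ h2
  linear_combination hb

end Ode

/-! ### The recurrence for the cumulants and its limit -/

theorem PowerSeries.coeff_X_mul_derivative {R : Type*} [CommRing R] (f : R⟦X⟧) (l : ℕ) :
    coeff l (X * d⁄dX R f) = l * coeff l f := by
  rcases l with _ | l
  · simp
  · rw [coeff_succ_X_mul, coeff_derivative]; push_cast; ring

/-- The Euler operator `θ = X d/dX` acts diagonally on coefficients. The linear part `θ³ + θ² - c (θ
+ 1)` acts at index `k` by `(k + 1) (k² - c)`, and all other nonconstant terms carry one factor `X`.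
-/
theorem coeff_succ_cumulant_ode (g : ℝ⟦X⟧) (c : ℝ) (l : ℕ) :
    let g₁ := d⁄dX ℝ g
    let g₂ := d⁄dX ℝ g₁
    let g₃ := d⁄dX ℝ g₂
    coeff (l + 1) (X * X * X * g₃ + C 6 * (X * X * X * (g₁ * g₁)) + C 4 * (X * X * g₂) +
      C 8 * (X * X * (g * g₁)) + C 4 * (X * X * g₁) + C 2 * (X * g₁) + C 2 * (X * g) +
      C 2 * (X * (g * g)) + C (-c) * (X * g₁ + g) + C c) =
    ((l : ℝ) + 2) * (((l : ℝ) + 1) ^ 2 - c) * coeff (l + 1) g + (4 * l + 2) * coeff l g +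
      ∑ i ∈ Finset.range (l + 1), (6 * (i : ℝ) * ((l : ℝ) - i) + 8 * ((l : ℝ) - i) + 2) *
        (coeff i g * coeff (l - i) g) := by
  intro g₁ g₂ g₃
  set t₁ := X * d⁄dX ℝ g with ht₁
  set t₂ := X * d⁄dX ℝ t₁ with ht₂
  set t₃ := X * d⁄dX ℝ t₂ with ht₃
  have e₂ : t₂ = X * g₁ + X * X * g₂ := by
    rw [ht₂, ht₁, Derivation.leibniz, derivative_X, smul_eq_mul, smul_eq_mul]; ring
  have e₃ : t₃ = X * g₁ + 3 * (X * X * g₂) + X * X * X * g₃ := by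
    rw [ht₃, e₂, map_add, Derivation.leibniz, Derivation.leibniz, Derivation.leibniz, derivative_X]
    simp only [smul_eq_mul]
    ring
  have hexpr : X * X * X * g₃ + C 6 * (X * X * X * (g₁ * g₁)) + C 4 * (X * X * g₂) +
      C 8 * (X * X * (g * g₁)) + C 4 * (X * X * g₁) + C 2 * (X * g₁) + C 2 * (X * g) +
      C 2 * (X * (g * g)) + C (-c) * (X * g₁ + g) + C c =
      t₃ + t₂ + C (-c) * (t₁ + g) + C c +
        X * (C 4 * t₁ + C 2 * g + ((C 6 * t₁ + C 8 * g) * t₁ + C 2 * g * g)) := by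
    have h4 : (C 4 : ℝ⟦X⟧) = 4 := map_ofNat C 4
    have h2 : (C 2 : ℝ⟦X⟧) = 2 := map_ofNat C 2
    rw [e₃, e₂, ht₁, h4, h2]
    ring
  have hc₁ : ∀ k, coeff k t₁ = k * coeff k g := fun k => coeff_X_mul_derivative g k
  have hc₂ : ∀ k, coeff k t₂ = k * (k * coeff k g) := fun k => by
    rw [ht₂, coeff_X_mul_derivative, hc₁]
  have hc₃ : ∀ k, coeff k t₃ = k * (k * (k * coeff k g)) := fun k => by
    rw [ht₃, coeff_X_mul_derivative, hc₂]
  rw [hexpr]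
  simp only [map_add, coeff_succ_X_mul, coeff_C_mul, hc₁, hc₂, hc₃, coeff_C,
    if_neg (Nat.succ_ne_zero l)]
  rw [coeff_mul, coeff_mul, Finset.Nat.sum_antidiagonal_eq_sum_range_succ_mk,
    Finset.Nat.sum_antidiagonal_eq_sum_range_succ_mk, ← Finset.sum_add_distrib]
  have hs : ∀ i ∈ Finset.range l.succ, coeff i (C 6 * t₁ + C 8 * g) * coeff (l - i) t₁ +
      coeff i (C 2 * g) * coeff (l - i) g =
      (6 * (i : ℝ) * ((l : ℝ) - i) + 8 * ((l : ℝ) - i) + 2) * (coeff i g * coeff (l - i) g) := by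
    intro i hi
    rw [map_add, coeff_C_mul, coeff_C_mul, coeff_C_mul, hc₁, hc₁,
      Nat.cast_sub (Nat.lt_succ_iff.1 (Finset.mem_range.1 hi))]
    ring
  rw [Finset.sum_congr rfl hs]
  push_cast
  ring

/-- The normalized cumulants `K_{l+1} / l!`. -/
noncomputable def normalizedCumulant (n l : ℕ) : ℝ :=
  delayCumulant n (l + 1) / (l.factorial : ℝ)

theorem coeff_derivative_delayJet (n l : ℕ) :
    coeff l (d⁄dX ℝ (delayJet n)) = normalizedCumulant n l := by
  rw [coeff_derivative, delayJet, coeff_mk, normalizedCumulant, Nat.factorial_succ]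
  push_cast
  field_simp

/-- At `X = 0` only `-n² g + n²` remains of the differential equation. -/
theorem normalizedCumulant_zero {n : ℕ} (hn : 4 ≤ n) : normalizedCumulant n 0 = 1 := by
  obtain ⟨N, rfl⟩ := Nat.exists_eq_add_of_le' hn
  have h := coeff_delayJet_ode (N := N) (l := 0) (Nat.zero_le _)
  simp only [coeff_zero_eq_constantCoeff, map_add, map_mul, constantCoeff_X, zero_mul, mul_zero,
    zero_add, constantCoeff_C] at h
  rw [← coeff_derivative_delayJet, coeff_zero_eq_constantCoeff]
  have h4 : ((N : ℝ) + 4) ^ 2 ≠ 0 := by positivity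
  apply mul_left_cancel₀ h4
  linear_combination -h

theorem normalizedCumulant_succ {n l : ℕ} (hn : l + 5 ≤ n) :
    ((l : ℝ) + 2) * ((n : ℝ) ^ 2 - ((l : ℝ) + 1) ^ 2) * normalizedCumulant n (l + 1) =
      (4 * l + 2) * normalizedCumulant n l +
      ∑ i ∈ Finset.range (l + 1), (6 * (i : ℝ) * ((l : ℝ) - i) + 8 * ((l : ℝ) - i) + 2) *
        (normalizedCumulant n i * normalizedCumulant n (l - i)) := by
  obtain ⟨N, rfl⟩ := Nat.exists_eq_add_of_le' (show 4 ≤ n by omega)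
  have h := coeff_delayJet_ode (N := N) (l := l + 1) (by omega)
  have h' := coeff_succ_cumulant_ode (d⁄dX ℝ (delayJet (N + 4))) (((N : ℝ) + 4) ^ 2) l
  simp only at h h'
  rw [h] at h'
  simp only [coeff_derivative_delayJet] at h'
  push_cast
  linear_combination h'

/-- The two kernels differ by `-6 (i - (l - i))`, which is antisymmetric under `i ↦ l - i`. -/
theorem sum_range_symmetrize (a : ℕ → ℝ) (l : ℕ) :
    ∑ i ∈ Finset.range (l + 1), (6 * (i : ℝ) * ((l : ℝ) - i) + 8 * ((l : ℝ) - i) + 2) *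
      (a i * a (l - i)) =
    2 * ∑ i ∈ Finset.range (l + 1), (3 * (i : ℝ) + 1) * ((l : ℝ) + 1 - i) * (a i * a (l - i)) := by
  have hflip : ∑ i ∈ Finset.range (l + 1), (i : ℝ) * (a i * a (l - i)) =
      ∑ i ∈ Finset.range (l + 1), ((l : ℝ) - i) * (a i * a (l - i)) := by
    rw [← Finset.sum_flip]
    refine Finset.sum_congr rfl fun i hi => ?_
    have hil : i ≤ l := Nat.lt_succ_iff.1 (Finset.mem_range.1 hi)
    rw [Nat.cast_sub hil, Nat.sub_sub_self hil, mul_comm (a i)]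
  rw [← sub_eq_zero, Finset.mul_sum, ← Finset.sum_sub_distrib]
  rw [← sub_eq_zero, ← Finset.sum_sub_distrib] at hflip
  calc _ = ∑ i ∈ Finset.range (l + 1), (-6) * ((i : ℝ) * (a i * a (l - i)) -
        ((l : ℝ) - i) * (a i * a (l - i))) := Finset.sum_congr rfl fun i _ => by ring
    _ = 0 := by rw [← Finset.mul_sum, hflip, mul_zero]

/-- Strong induction. The powers of `n` match in each product because the indices sum to `l`, and
`n² - (l + 1)²` divided by `n²` tends to `1`. -/
theorem tendsto_normalizedCumulant {p : ℕ → ℤ} (hp1 : p 1 = 1)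
    (hp : ∀ l : ℕ, 1 ≤ l →
        ((l : ℤ) + 1) * p (l + 1) = 2 * (2 * (l : ℤ) - 1) * p l +
          2 * ∑ i ∈ Finset.range l,
            (3 * (i : ℤ) + 1) * ((l : ℤ) - (i : ℤ)) * p (i + 1) * p (l - i)) (l : ℕ) :
    Tendsto (fun n : ℕ => (n : ℝ) ^ (2 * l) * normalizedCumulant n l) atTop (𝓝 (p (l + 1) : ℝ)) := by
  induction l using Nat.strong_induction_on with
  | _ l ih =>
  rcases l with _ | l
  · refine tendsto_const_nhds.congr' ?_
    filter_upwards [eventually_ge_atTop 4] with n hn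
    rw [normalizedCumulant_zero hn, hp1]
    simp
  · set q : ℕ → ℕ → ℝ := fun n l => (n : ℝ) ^ (2 * l) * normalizedCumulant n l with hq
    have hR : Tendsto (fun n : ℕ => (4 * (l : ℝ) + 2) * q n l +
        ∑ i ∈ Finset.range (l + 1), (6 * (i : ℝ) * ((l : ℝ) - i) + 8 * ((l : ℝ) - i) + 2) *
          (q n i * q n (l - i))) atTop (𝓝 ((4 * (l : ℝ) + 2) * p (l + 1) +
        ∑ i ∈ Finset.range (l + 1), (6 * (i : ℝ) * ((l : ℝ) - i) + 8 * ((l : ℝ) - i) + 2) *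
          ((p (i + 1) : ℝ) * p (l - i + 1)))) := by
      refine ((ih l (Nat.lt_succ_self l)).const_mul _).add (tendsto_finsetSum _ fun i hi => ?_)
      have hi' := Finset.mem_range.1 hi
      exact ((ih i hi').mul (ih (l - i) (by omega))).const_mul _
    have hD : Tendsto (fun n : ℕ => ((l : ℝ) + 2) * (1 - ((l : ℝ) + 1) ^ 2 * ((n : ℝ)⁻¹) ^ 2)) atTop
        (𝓝 (((l : ℝ) + 2) * (1 - ((l : ℝ) + 1) ^ 2 * 0 ^ 2))) :=
      ((((tendsto_inv_atTop_nhds_zero_nat (𝕜 := ℝ)).pow 2).const_mul _).const_sub 1).const_mul _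
    have hl2 : ((l : ℝ) + 2) * (1 - ((l : ℝ) + 1) ^ 2 * 0 ^ 2) ≠ 0 := by
      have : ((l : ℝ) + 2) * (1 - ((l : ℝ) + 1) ^ 2 * 0 ^ 2) = (l : ℝ) + 2 := by ring
      rw [this]; positivity
    have hlim := hR.div hD hl2
    have hval : ((4 * (l : ℝ) + 2) * p (l + 1) +
        ∑ i ∈ Finset.range (l + 1), (6 * (i : ℝ) * ((l : ℝ) - i) + 8 * ((l : ℝ) - i) + 2) *
          ((p (i + 1) : ℝ) * p (l - i + 1))) / (((l : ℝ) + 2) * (1 - ((l : ℝ) + 1) ^ 2 * 0 ^ 2)) =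
        p (l + 1 + 1) := by
      rw [div_eq_iff hl2, sum_range_symmetrize (fun i => (p (i + 1) : ℝ))]
      have h := congrArg (Int.cast : ℤ → ℝ) (hp (l + 1) (by omega))
      push_cast at h
      have hs : ∑ i ∈ Finset.range (l + 1), (3 * (i : ℝ) + 1) * ((l : ℝ) + 1 - i) * p (i + 1) *
          p (l + 1 - i) = ∑ i ∈ Finset.range (l + 1), (3 * (i : ℝ) + 1) * ((l : ℝ) + 1 - i) *
          ((p (i + 1) : ℝ) * p (l - i + 1)) := by
        refine Finset.sum_congr rfl fun i hi => ?_
        have := Finset.mem_range.1 hi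
        rw [show l + 1 - i = l - i + 1 by omega]
        ring
      rw [hs] at h
      linear_combination -h
    rw [hval] at hlim
    refine hlim.congr' ?_
    filter_upwards [eventually_ge_atTop (l + 5)] with n hn
    have hn0 : (n : ℝ) ≠ 0 := by
      have : 0 < n := by omega
      positivity
    have hln : (l : ℝ) + 1 < n := by
      have : l + 1 < n := by omega
      exact_mod_cast this
    have hpos : 0 < (n : ℝ) ^ 2 - ((l : ℝ) + 1) ^ 2 := by
      have : (0 : ℝ) ≤ (l : ℝ) + 1 := by positivity
      nlinarith
    have hden : ((l : ℝ) + 2) * (1 - ((l : ℝ) + 1) ^ 2 * ((n : ℝ)⁻¹) ^ 2) =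
        ((l : ℝ) + 2) * ((n : ℝ) ^ 2 - ((l : ℝ) + 1) ^ 2) / (n : ℝ) ^ 2 := by
      field_simp
    have hden0 : ((l : ℝ) + 2) * (1 - ((l : ℝ) + 1) ^ 2 * ((n : ℝ)⁻¹) ^ 2) ≠ 0 := by
      rw [hden]; positivity
    simp only [Pi.div_apply]
    rw [div_eq_iff hden0, hden]
    have hsum : ∑ i ∈ Finset.range (l + 1), (6 * (i : ℝ) * ((l : ℝ) - i) + 8 * ((l : ℝ) - i) + 2) *
          (q n i * q n (l - i)) = (n : ℝ) ^ (2 * l) *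
        ∑ i ∈ Finset.range (l + 1), (6 * (i : ℝ) * ((l : ℝ) - i) + 8 * ((l : ℝ) - i) + 2) *
          (normalizedCumulant n i * normalizedCumulant n (l - i)) := by
      rw [Finset.mul_sum]
      refine Finset.sum_congr rfl fun i hi => ?_
      have hil : i ≤ l := Nat.lt_succ_iff.1 (Finset.mem_range.1 hi)
      have : (n : ℝ) ^ (2 * l) = (n : ℝ) ^ (2 * i) * (n : ℝ) ^ (2 * (l - i)) := by
        rw [← pow_add]; congr 1; omega
      rw [this, hq]
      ring
    rw [hsum, hq]
    have hpow : (n : ℝ) ^ (2 * (l + 1)) = (n : ℝ) ^ (2 * l) * (n : ℝ) ^ 2 := by ring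
    have hcancel : ∀ x g a : ℝ, x * (n : ℝ) ^ 2 * g * (a / (n : ℝ) ^ 2) = x * (a * g) := by
      intro x g a
      field_simp
    have hrec := normalizedCumulant_succ hn
    rw [hpow, hcancel, hrec]
    ring

/-! ### The main theorem -/

theorem theorem5 :
    -- the cumulants are the coefficients of the asymptotic expansion of the generating function
    (∀ n : ℕ, 1 ≤ n →
      (fun z : ℝ => delayCgf n z -
          ∑ l ∈ Finset.Icc 1 n, delayCumulant n l / (l.factorial : ℝ) * z ^ l)
        =o[𝓝[≤] (0 : ℝ)] fun z : ℝ => z ^ n) ∧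
    ∃ p : ℕ → ℤ,
      -- the limit exists and is an integer
      (∀ l : ℕ, 1 ≤ l →
        Tendsto (fun n : ℕ =>
            (n : ℝ) ^ (2 * l - 2) * delayCumulant n l / ((l - 1).factorial : ℝ))
          atTop (𝓝 (p l : ℝ))) ∧
      -- recurrence relation and initial condition
      p 1 = 1 ∧
      (∀ l : ℕ, 1 ≤ l →
        ((l : ℤ) + 1) * p (l + 1) = 2 * (2 * (l : ℤ) - 1) * p l +
          2 * ∑ i ∈ Finset.range l,
            (3 * (i : ℤ) + 1) * ((l : ℤ) - (i : ℤ)) * p (i + 1) * p (l - i)) ∧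
      -- generating function
      genSeries p = C (3 / 2 : ℚ) - C (3 / 2 : ℚ) * omegaSeries + 2 * X * omegaSeries ^ 3 +
        3 * X * omegaSeries ^ 2 + 2 * X * omegaSeries ∧
      -- `Ω` is the unique root of the quartic with constant term `1`
      (IsQuarticRoot omegaSeries ∧
        ∀ W : PowerSeries ℚ, IsQuarticRoot W → constantCoeff W = 1 → W = omegaSeries) ∧
      -- the coefficients of `Ω` are integers
      (∀ k : ℕ, 1 ≤ k → ∃ m : ℤ, zetaCoeff k = (m : ℚ)) ∧
      -- both series have a positive radius of convergence
      (∃ r : ℝ, 0 < r ∧ ∀ z : ℂ, ‖z‖ < r →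
        (Summable fun k : ℕ => ((coeff k omegaSeries : ℚ) : ℂ) * z ^ k) ∧
        (Summable fun k : ℕ => ((coeff k (genSeries p) : ℚ) : ℂ) * z ^ k)) := by
  obtain ⟨p, hp1, hp, hgen, hΩ, hint, hr⟩ := exists_delay_coefficients
  refine ⟨fun n hn => delayCgf_sub_isLittleO hn, p, fun l hl => ?_, hp1, hp, hgen, hΩ, hint, hr⟩
  obtain ⟨k, rfl⟩ := Nat.exists_eq_add_of_le' hl
  refine (tendsto_normalizedCumulant hp1 hp k).congr fun n => ?_
  rw [normalizedCumulant, show 2 * (k + 1) - 2 = 2 * k by omega, Nat.add_sub_cancel, mul_div_assoc]
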